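/- For $0<p<\infty$ and $n\in\mathbb{N}=\{1,2,\dots\}$ let $\ell_p^n$ be $\mathbb{C}^n$ with the (quasi-)norm $\|x\|_p=\big(\sum_{j=1}^n|x_j|^p\big)^{1/p}$, let $\ell_\infty^n$ be $\mathbb{C}^n$ with $\|x\|_\infty=\max_{1\le j\le n}|x_j|$, and let $\overline{B}_p^n=\{x\in\mathbb{C}^n:\|x\|_p\le 1\}$. For $k\in\mathbb{N}$ let $$e_k(\mathrm{id}:\ell_p^n\to\ell_q^n)=\inf\Big\{\varepsilon>0:\ \exists\, y_1,\dots,y_{2^{k-1}}\in\mathbb{C}^n\ \text{ with }\ \overline{B}_p^n\subseteq\bigcup_{i=1}^{2^{k-1}}\big(y_i+\varepsilon\overline{B}_q^n\big)\Big\}$$ be the $k$-th (dyadic) entropy number of the identity operator. Let $0<p\le q\le\infty$, with the convention $1/\infty=0$. Then there are constants $c,C>0$, depending only on $p$ and $q$, such that for all $n,k\in\mathbb{N}$ the following hold: (i) if $1\le k\le\log_2(2n)$, then $c\le e_k(\mathrm{id}:\ell_p^n\to\ell_q^n)\le C$; (ii) if $\log_2(2n)\le k\le 2n$, then $$c\,\Big(k^{-1}\log_2\big(1+\tfrac{2n}{k}\big)\Big)^{\frac1p-\frac1q}\le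 e_k(\mathrm{id}:\ell_p^n\to\ell_q^n)\le C\,\Big(k^{-1}\log_2\big(1+\tfrac{2n}{k}\big)\Big)^{\frac1p-\frac1q};$$ (iii) if $k\ge 2n$, then $$c\,2^{-\frac{k}{2n}}(2n)^{\frac1q-\frac1p}\le e_k(\mathrm{id}:\ell_p^n\to\ell_q^n)\le C\,2^{-\frac{k}{2n}}(2n)^{\frac1q-\frac1p}.$$ -/

import Mathlib

open scoped ENNReal

/-- The closed unit ball `{x : ‖x‖ ≤ 1}` of a (quasi-)normed space. -/
def closedUnitBall (X : Type*) [Norm X] : Set X := {x | ‖x‖ ≤ 1}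

/-- The `k`-th dyadic entropy number `e_k(T)`, `k ≥ 1`, of a linear operator between (quasi-)normed
spaces: the infimum of all `ε > 0` such that the image of the closed unit ball of `X` is covered by
`2 ^ (k - 1)` translates `y + ε B` of the `ε`-multiple of the closed unit ball `B` of `Y`. -/
noncomputable def entropyNumber {X Y : Type*} [AddCommGroup X] [Module ℂ X] [Norm X]
    [AddCommGroup Y] [Module ℂ Y] [Norm Y] (k : ℕ) (T : X →ₗ[ℂ] Y) : ℝ :=
  sInf {ε : ℝ | 0 < ε ∧ ∃ y : Fin (2 ^ (k - 1)) → Y,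
    T '' closedUnitBall X ⊆ ⋃ i, {v : Y | ∃ z ∈ closedUnitBall Y, v = y i + (ε : ℂ) • z}}

/-- The complex space `ℓ_p^n`, that is `ℂ^n` with `(∑ |x_j|^p)^{1/p}` (`p < ∞`), respectively
`max |x_j|` (`p = ∞`). The `Norm` on `PiLp` is given by this formula for all `0 < p ≤ ∞`. -/
abbrev EllP (p : ℝ≥0∞) (n : ℕ) : Type := PiLp p (fun _ : Fin n => ℂ)

theorem EllP.norm_eq {p : ℝ≥0∞} (hp : 0 < p) (hp' : p ≠ ∞) {n : ℕ} (x : EllP p n) :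
    ‖x‖ = (∑ j, ‖x j‖ ^ p.toReal) ^ (1 / p.toReal) :=
  PiLp.norm_eq_sum (ENNReal.toReal_pos hp.ne' hp') x

theorem EllP.norm_eq_top {n : ℕ} (x : EllP ∞ n) : ‖x‖ = ⨆ j, ‖x j‖ :=
  PiLp.norm_eq_ciSup x

/-- The identity operator `ℓ_p^n → ℓ_q^n`. -/
def idEll (p q : ℝ≥0∞) (n : ℕ) : EllP p n →ₗ[ℂ] EllP q n :=
  (WithLp.linearEquiv q ℂ (Fin n → ℂ)).symm.toLinearMap ∘ₗ
    (WithLp.linearEquiv p ℂ (Fin n → ℂ)).toLinearMap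

theorem idEll_apply (p q : ℝ≥0∞) (n : ℕ) (x : EllP p n) (j : Fin n) : idEll p q n x j = x j := rfl

/-- The exponent `1/p - 1/q`, with `1/∞ = 0`. -/
noncomputable def expDiff (p q : ℝ≥0∞) : ℝ := (p⁻¹).toReal - (q⁻¹).toReal

/-! Upper bounds come from rounding and lower bounds from packing or volume. For `k ≤ 2n`, round the
`2n` real coordinates of a point of the `ℓ_p` ball to multiples of `ε`. The grid points used are
integer points of an `ℓ_p` ball, and an exponential-moment estimate (`exists_card_intBall_le`)
counts them. With `ε ^ p` of order `log (1 + 2n/k) / k`, at most `2 ^ (k - 1)` are needed. The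
rounding error has small sup norm and still lies in the `ℓ_p` unit ball, so interpolation gives the
`ℓ_q` bound. For `k ≥ 2n`, the sup-norm cover obtained at `2n` is refined by cutting each cube into
equal subcubes (`entropyNumber_le_of_subdivision`).

The lower bound for the smallest `k` is a pigeonhole on `0` and the unit vectors. Comparing the
volume of a polydisc inside the `ℓ_p` ball with that of `ℓ_q` balls settles `k ≥ 2n`, and also those
`k ≤ 2n` that are comparable with `n`. When `k` is much smaller than `n`, volume is too weak. Sparse
vectors with about `k / log (1 + 2n/k)` equal nonzero entries, indexed by words over a large
alphabet, replace it: too many words fall into one ball to be pairwise close in Hamming distance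
(`le_entropyNumber_of_code`). -/

/-! ### Norm estimates valid for all `0 < p ≤ ∞`. -/

/-- The `ℓ_p` (quasi-)norm of a plain vector in `ℂ^n`. -/
noncomputable def ellNorm (p : ℝ≥0∞) {n : ℕ} (x : Fin n → ℂ) : ℝ :=
  ‖(WithLp.toLp p x : EllP p n)‖

theorem ellNorm_eq {p : ℝ≥0∞} (hp : 0 < p) (hp' : p ≠ ∞) {n : ℕ} (x : Fin n → ℂ) :
    ellNorm p x = (∑ j, ‖x j‖ ^ p.toReal) ^ (1 / p.toReal) :=
  EllP.norm_eq hp hp' _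

theorem ellNorm_top {n : ℕ} (x : Fin n → ℂ) : ellNorm ∞ x = ⨆ j, ‖x j‖ := rfl

theorem ellNorm_nonneg {p : ℝ≥0∞} (hp : 0 < p) {n : ℕ} (x : Fin n → ℂ) : 0 ≤ ellNorm p x := by
  by_cases h : p = ∞
  · subst h
    rw [ellNorm_top]
    exact Real.iSup_nonneg fun _ => norm_nonneg _
  · rw [ellNorm_eq hp h]
    positivity

theorem ellNorm_le_iff {p : ℝ≥0∞} (hp : 0 < p) (hp' : p ≠ ∞) {n : ℕ} (x : Fin n → ℂ) {r : ℝ}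
    (hr : 0 ≤ r) : ellNorm p x ≤ r ↔ ∑ j, ‖x j‖ ^ p.toReal ≤ r ^ p.toReal := by
  have h := ENNReal.toReal_pos hp.ne' hp'
  rw [ellNorm_eq hp hp', one_div, Real.rpow_inv_le_iff_of_pos (by positivity) hr h]

theorem le_ellNorm_iff {p : ℝ≥0∞} (hp : 0 < p) (hp' : p ≠ ∞) {n : ℕ} (x : Fin n → ℂ) {r : ℝ}
    (hr : 0 ≤ r) : r ≤ ellNorm p x ↔ r ^ p.toReal ≤ ∑ j, ‖x j‖ ^ p.toReal := by
  have h := ENNReal.toReal_pos hp.ne' hp'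
  rw [ellNorm_eq hp hp', one_div, Real.le_rpow_inv_iff_of_pos hr (by positivity) h]

theorem ellNorm_top_le_iff {n : ℕ} (x : Fin n → ℂ) {r : ℝ} (hr : 0 ≤ r) :
    ellNorm ∞ x ≤ r ↔ ∀ j, ‖x j‖ ≤ r := by
  rw [ellNorm_top]
  exact ⟨fun h j => (le_ciSup (Set.finite_range _).bddAbove j).trans h, fun h => Real.iSup_le h hr⟩

theorem norm_apply_le_ellNorm {p : ℝ≥0∞} (hp : 0 < p) {n : ℕ} (x : Fin n → ℂ) (j : Fin n) :
    ‖x j‖ ≤ ellNorm p x := by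
  by_cases h : p = ∞
  · subst h
    exact (ellNorm_top_le_iff x (ellNorm_nonneg hp x)).1 le_rfl j
  · rw [le_ellNorm_iff hp h _ (norm_nonneg _)]
    exact Finset.single_le_sum (f := fun j => ‖x j‖ ^ p.toReal) (fun i _ => by positivity)
      (Finset.mem_univ j)

/-- Interpolation of the `ℓ_q` norm between `ℓ_p` and `ℓ_∞`. -/
theorem ellNorm_le_of_interpolation {p q : ℝ≥0∞} (hp : 0 < p) (hp' : p ≠ ∞) (hpq : p ≤ q) {n : ℕ}
    (x : Fin n → ℂ) {ε : ℝ} (hε : 0 < ε) (h1 : ellNorm p x ≤ 1) (h2 : ∀ j, ‖x j‖ ≤ ε) :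
    ellNorm q x ≤ ε ^ (p.toReal * expDiff p q) := by
  have hpp := ENNReal.toReal_pos hp.ne' hp'
  by_cases h : q = ∞
  · subst h
    simp only [expDiff, ENNReal.toReal_inv, ENNReal.inv_top, ENNReal.toReal_zero, sub_zero]
    rw [mul_inv_cancel₀ hpp.ne', Real.rpow_one]
    exact (ellNorm_top_le_iff x hε.le).2 h2
  · have hq := hp.trans_le hpq
    have hqq := ENNReal.toReal_pos hq.ne' h
    have hle : p.toReal ≤ q.toReal := ENNReal.toReal_mono h hpq
    rw [ellNorm_le_iff hq h _ (by positivity), ← Real.rpow_mul hε.le]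
    have he : p.toReal * expDiff p q * q.toReal = q.toReal - p.toReal := by
      simp only [expDiff, ENNReal.toReal_inv]
      field_simp
    rw [he]
    rw [ellNorm_le_iff hp hp' _ zero_le_one, Real.one_rpow] at h1
    calc ∑ j, ‖x j‖ ^ q.toReal ≤ ∑ j, ε ^ (q.toReal - p.toReal) * ‖x j‖ ^ p.toReal := by
          refine Finset.sum_le_sum fun j _ => ?_
          calc ‖x j‖ ^ q.toReal = ‖x j‖ ^ (q.toReal - p.toReal) * ‖x j‖ ^ p.toReal := by
                rw [← Real.rpow_add_of_nonneg (norm_nonneg _) (by linarith) hpp.le]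
                congr 1
                ring
            _ ≤ _ := by
                gcongr
                exact h2 j
      _ = ε ^ (q.toReal - p.toReal) * ∑ j, ‖x j‖ ^ p.toReal := by rw [Finset.mul_sum]
      _ ≤ ε ^ (q.toReal - p.toReal) * 1 := by gcongr
      _ = _ := mul_one _

theorem ellNorm_le_one_of_le {p q : ℝ≥0∞} (hp : 0 < p) (hpq : p ≤ q) {n : ℕ}
    (x : Fin n → ℂ) (h1 : ellNorm p x ≤ 1) : ellNorm q x ≤ 1 := by
  by_cases h : p = ∞
  · subst h
    rwa [top_le_iff.1 hpq]
  · simpa using ellNorm_le_of_interpolation hp h hpq x one_pos h1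
      fun j => (norm_apply_le_ellNorm hp x j).trans h1

theorem expDiff_nonneg {p q : ℝ≥0∞} (hp : 0 < p) (hpq : p ≤ q) : 0 ≤ expDiff p q :=
  sub_nonneg.2 (ENNReal.toReal_mono (ENNReal.inv_ne_top.2 hp.ne') (ENNReal.inv_le_inv.2 hpq))

/-- A vector supported on `m` coordinates with entries bounded by `a` has norm at most
`a m^{1/p}`. -/
theorem ellNorm_le_of_support {p : ℝ≥0∞} (hp : 0 < p) {n : ℕ} (x : Fin n → ℂ) {a : ℝ} (ha : 0 ≤ a)
    (S : Finset (Fin n)) {m : ℕ} (hm : 1 ≤ m) (hS : S.card ≤ m) (h1 : ∀ j ∈ S, ‖x j‖ ≤ a)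
    (h0 : ∀ j ∉ S, x j = 0) : ellNorm p x ≤ a * (m : ℝ) ^ (p⁻¹).toReal := by
  by_cases h : p = ∞
  · subst h
    simp only [ENNReal.inv_top, ENNReal.toReal_zero, Real.rpow_zero, mul_one]
    refine (ellNorm_top_le_iff x ha).2 fun j => ?_
    by_cases hj : j ∈ S
    · exact h1 j hj
    · simpa [h0 j hj] using ha
  · have hpp := ENNReal.toReal_pos hp.ne' h
    rw [ellNorm_le_iff hp h _ (by positivity), Real.mul_rpow ha (by positivity),
      ← Real.rpow_mul (by positivity), ENNReal.toReal_inv, inv_mul_cancel₀ hpp.ne', Real.rpow_one]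
    calc ∑ j, ‖x j‖ ^ p.toReal = ∑ j ∈ S, ‖x j‖ ^ p.toReal := by
          refine (Finset.sum_subset (Finset.subset_univ S) fun j _ hj => ?_).symm
          rw [h0 j hj, norm_zero, Real.zero_rpow hpp.ne']
      _ ≤ ∑ j ∈ S, a ^ p.toReal := Finset.sum_le_sum fun j hj => by
          have := h1 j hj
          gcongr
      _ = S.card * a ^ p.toReal := by simp
      _ ≤ m * a ^ p.toReal := by gcongr
      _ = _ := mul_comm _ _

/-- A vector with at least `s` entries of modulus at least `a` has norm at least `a s^{1/p}`. -/
theorem le_ellNorm_of_le {p : ℝ≥0∞} (hp : 0 < p) {n : ℕ} (x : Fin n → ℂ) {a : ℝ} (ha : 0 ≤ a)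
    (S : Finset (Fin n)) (hne : S.Nonempty) {s : ℝ} (hs : 0 ≤ s) (hS : s ≤ S.card)
    (h1 : ∀ j ∈ S, a ≤ ‖x j‖) : a * s ^ (p⁻¹).toReal ≤ ellNorm p x := by
  by_cases h : p = ∞
  · subst h
    simp only [ENNReal.inv_top, ENNReal.toReal_zero, Real.rpow_zero, mul_one]
    obtain ⟨j, hj⟩ := hne
    exact (h1 j hj).trans (norm_apply_le_ellNorm hp x j)
  · have hpp := ENNReal.toReal_pos hp.ne' h
    rw [le_ellNorm_iff hp h _ (by positivity), Real.mul_rpow ha (by positivity),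
      ← Real.rpow_mul hs, ENNReal.toReal_inv, inv_mul_cancel₀ hpp.ne', Real.rpow_one]
    calc a ^ p.toReal * s ≤ a ^ p.toReal * S.card := by gcongr
      _ = ∑ j ∈ S, a ^ p.toReal := by simp [mul_comm]
      _ ≤ ∑ j ∈ S, ‖x j‖ ^ p.toReal := Finset.sum_le_sum fun j hj => by
          have := h1 j hj
          gcongr
      _ ≤ ∑ j, ‖x j‖ ^ p.toReal :=
          Finset.sum_le_sum_of_subset_of_nonneg (Finset.subset_univ _) fun _ _ _ => by positivity

/-- Quasi-triangle inequality for points of one ball. -/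
theorem ellNorm_sub_le {p : ℝ≥0∞} (hp : 0 < p) {n : ℕ} (x y : Fin n → ℂ) {ε : ℝ} (hε : 0 ≤ ε)
    (hx : ellNorm p x ≤ ε) (hy : ellNorm p y ≤ ε) :
    ellNorm p (x - y) ≤ 2 * 2 ^ (p⁻¹).toReal * ε := by
  by_cases h : p = ∞
  · subst h
    simp only [ENNReal.inv_top, ENNReal.toReal_zero, Real.rpow_zero, mul_one]
    rw [ellNorm_top_le_iff _ (by positivity)]
    intro j
    have h1 := (norm_apply_le_ellNorm hp x j).trans hx
    have h2 := (norm_apply_le_ellNorm hp y j).trans hy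
    have := norm_sub_le (x j) (y j)
    simp only [Pi.sub_apply]
    linarith
  · have hpp := ENNReal.toReal_pos hp.ne' h
    rw [ellNorm_le_iff hp h _ (by positivity), Real.mul_rpow (by positivity) hε,
      Real.mul_rpow (by positivity) (by positivity), ← Real.rpow_mul (by positivity),
      ENNReal.toReal_inv, inv_mul_cancel₀ hpp.ne', Real.rpow_one]
    rw [ellNorm_le_iff hp h _ hε] at hx hy
    calc ∑ j, ‖(x - y) j‖ ^ p.toReal
        ≤ ∑ j, 2 ^ p.toReal * (‖x j‖ ^ p.toReal + ‖y j‖ ^ p.toReal) := by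
          refine Finset.sum_le_sum fun j _ => ?_
          -- Bounding by the larger of the two moduli works for every `p > 0`, with no split at `p =
          -- 1`.
          have h3 : ‖(x - y) j‖ ≤ 2 * max ‖x j‖ ‖y j‖ := by
            have := norm_sub_le (x j) (y j)
            have := le_max_left ‖x j‖ ‖y j‖
            have := le_max_right ‖x j‖ ‖y j‖
            simp only [Pi.sub_apply]
            linarith
          have hx0 : 0 ≤ ‖x j‖ ^ p.toReal := by positivity
          have hy0 : 0 ≤ ‖y j‖ ^ p.toReal := by positivity
          calc ‖(x - y) j‖ ^ p.toReal ≤ (2 * max ‖x j‖ ‖y j‖) ^ p.toReal := by gcongr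
            _ = 2 ^ p.toReal * (max ‖x j‖ ‖y j‖) ^ p.toReal :=
                Real.mul_rpow (by positivity) (by positivity)
            _ ≤ _ := by
                gcongr
                rcases max_cases ‖x j‖ ‖y j‖ with h | h <;> rw [h.1] <;> linarith
      _ = 2 ^ p.toReal * (∑ j, ‖x j‖ ^ p.toReal + ∑ j, ‖y j‖ ^ p.toReal) := by
          rw [← Finset.mul_sum, Finset.sum_add_distrib]
      _ ≤ 2 ^ p.toReal * (ε ^ p.toReal + ε ^ p.toReal) := by gcongr
      _ = _ := by ring

theorem ellNorm_real_smul {p : ℝ≥0∞} (hp : 0 < p) {n : ℕ} (x : Fin n → ℂ) {c : ℝ} (hc : 0 ≤ c) :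
    ellNorm p ((c : ℂ) • x) = c * ellNorm p x := by
  by_cases h : p = ∞
  · subst h
    rw [ellNorm_top, ellNorm_top, Real.mul_iSup_of_nonneg hc]
    simp [abs_of_nonneg hc]
  · have hpp := ENNReal.toReal_pos hp.ne' h
    rw [ellNorm_eq hp h, ellNorm_eq hp h]
    simp only [Pi.smul_apply, smul_eq_mul, norm_mul, Complex.norm_real, Real.norm_eq_abs,
      abs_of_nonneg hc]
    simp_rw [Real.mul_rpow hc (norm_nonneg _)]
    rw [← Finset.mul_sum, Real.mul_rpow (by positivity) (by positivity), ← Real.rpow_mul hc,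
      mul_one_div_cancel hpp.ne', Real.rpow_one]

/-! ### Entropy numbers in terms of coverings. -/

theorem mem_translate_iff {q : ℝ≥0∞} (hq : 0 < q) {n : ℕ} {ε : ℝ} (hε : 0 < ε) (y v : EllP q n) :
    (∃ z ∈ closedUnitBall (EllP q n), v = y + (ε : ℂ) • z) ↔
      ellNorm q (v.ofLp - y.ofLp) ≤ ε := by
  constructor
  · rintro ⟨z, hz, rfl⟩
    have : (y + (ε : ℂ) • z).ofLp - y.ofLp = (ε : ℂ) • z.ofLp := by simp
    rw [this, ellNorm_real_smul hq _ hε.le]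
    have hz' : ellNorm q z.ofLp ≤ 1 := hz
    nlinarith
  · intro h
    refine ⟨((ε⁻¹ : ℝ) : ℂ) • (v - y), ?_, ?_⟩
    · change ellNorm q (((ε⁻¹ : ℝ) : ℂ) • (v.ofLp - y.ofLp)) ≤ 1
      rw [ellNorm_real_smul hq _ (by positivity)]
      calc ε⁻¹ * ellNorm q (v.ofLp - y.ofLp) ≤ ε⁻¹ * ε := by gcongr
        _ = 1 := inv_mul_cancel₀ hε.ne'
    · have : (ε : ℂ) ≠ 0 := by exact_mod_cast hε.ne'
      rw [smul_smul]
      simp [this]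

theorem entropyNumber_le_of_cover {p q : ℝ≥0∞} (hq : 0 < q) {n k : ℕ} {ε : ℝ} (hε : 0 < ε)
    (T : Finset (Fin n → ℂ)) (hT : T.card ≤ 2 ^ (k - 1))
    (h : ∀ x, ellNorm p x ≤ 1 → ∃ y ∈ T, ellNorm q (x - y) ≤ ε) :
    entropyNumber k (idEll p q n) ≤ ε := by
  refine csInf_le ⟨0, fun _ h => h.1.le⟩ ⟨hε, ?_⟩
  -- The list of centres is padded with `0` when `T` has fewer than `2 ^ (k - 1)` elements.
  refine ⟨fun i => WithLp.toLp q
    (if hi : (i : ℕ) < T.card then (T.equivFin.symm ⟨i, hi⟩ : Fin n → ℂ) else 0), ?_⟩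
  rintro _ ⟨x, hx, rfl⟩
  obtain ⟨y, hy, hxy⟩ := h x.ofLp hx
  rw [Set.mem_iUnion]
  refine ⟨⟨T.equivFin ⟨y, hy⟩, (T.equivFin ⟨y, hy⟩).2.trans_le hT⟩, ?_⟩
  rw [Set.mem_ofPred_eq, mem_translate_iff hq hε]
  change ellNorm q (x.ofLp - _) ≤ ε
  simpa using hxy

theorem le_entropyNumber_of_cover {p q : ℝ≥0∞} (hp : 0 < p) (hpq : p ≤ q) {n k : ℕ} {c : ℝ}
    (h : ∀ ε : ℝ, 0 < ε → ∀ y : Fin (2 ^ (k - 1)) → Fin n → ℂ,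
      (∀ x, ellNorm p x ≤ 1 → ∃ i, ellNorm q (x - y i) ≤ ε) → c ≤ ε) :
    c ≤ entropyNumber k (idEll p q n) := by
  have hq := hp.trans_le hpq
  -- The set of admissible radii is nonempty: since `p ≤ q`, radius `1` works with all centres at
  -- `0`.
  refine le_csInf ⟨1, one_pos, fun _ => 0, ?_⟩ ?_
  · rintro _ ⟨x, hx, rfl⟩
    rw [Set.mem_iUnion]
    refine ⟨⟨0, by positivity⟩, ?_⟩
    rw [Set.mem_ofPred_eq, mem_translate_iff hq one_pos]
    change ellNorm q (x.ofLp - _) ≤ 1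
    simpa using ellNorm_le_one_of_le hp hpq x.ofLp hx
  · rintro ε ⟨hε, y, hy⟩
    refine h ε hε (fun i => (y i).ofLp) fun x hx => ?_
    have := hy ⟨WithLp.toLp p x, hx, rfl⟩
    rw [Set.mem_iUnion] at this
    obtain ⟨i, hi⟩ := this
    exact ⟨i, (mem_translate_iff hq hε _ _).1 hi⟩

theorem ellNorm_zero {p : ℝ≥0∞} (hp : 0 < p) {n : ℕ} : ellNorm p (0 : Fin n → ℂ) = 0 := by
  simpa using ellNorm_real_smul hp (0 : Fin n → ℂ) le_rfl

theorem entropyNumber_le_one {p q : ℝ≥0∞} (hp : 0 < p) (hpq : p ≤ q) (n k : ℕ) :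
    entropyNumber k (idEll p q n) ≤ 1 :=
  entropyNumber_le_of_cover (hp.trans_le hpq) one_pos {0} (by simpa using Nat.one_le_two_pow)
    fun x hx => ⟨0, by simp, by simpa using ellNorm_le_one_of_le hp hpq x hx⟩

/-! ### Counting integer points in `ℓ_p` balls. -/

/-- The exponential beats any power of `t ^ p`. The decay rate `3` exceeds the real dimension of
`ℂ`, so the same bound serves sums over `ℤ` and integrals over `ℂ`. -/
theorem exists_exp_neg_rpow_le {p : ℝ} (hp : 0 < p) :
    ∃ C : ℝ, 0 < C ∧ ∀ t : ℝ, 0 ≤ t → Real.exp (-t ^ p) ≤ C * (1 + t) ^ (-3 : ℝ) := by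
  obtain ⟨m, hm⟩ := exists_nat_ge (3 / p)
  rw [div_le_iff₀ hp] at hm
  have hf : (1 : ℝ) ≤ m.factorial := by exact_mod_cast Nat.one_le_iff_ne_zero.2 m.factorial_ne_zero
  refine ⟨8 * m.factorial, by positivity, fun t ht => ?_⟩
  have h1 : 1 ≤ Real.exp (t ^ p) := Real.one_le_exp (by positivity)
  have h2 : t ^ (m * p) ≤ m.factorial * Real.exp (t ^ p) := by
    have := Real.pow_div_factorial_le_exp (t ^ p) (by positivity) m
    rw [div_le_iff₀ (by positivity), ← Real.rpow_mul_natCast ht] at this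
    rw [mul_comm (m : ℝ) p]
    linarith
  have h3 : (1 + t) ^ (3 : ℝ) ≤ 8 * m.factorial * Real.exp (t ^ p) := by
    rcases le_total t 1 with h | h
    · calc (1 + t) ^ (3 : ℝ) ≤ 2 ^ (3 : ℝ) := by gcongr ?_ ^ (3 : ℝ); linarith
        _ = 8 := by norm_num
        _ ≤ _ := by nlinarith
    · calc (1 + t) ^ (3 : ℝ) ≤ (2 * t) ^ (3 : ℝ) := by gcongr ?_ ^ (3 : ℝ); linarith
        _ = 8 * t ^ (3 : ℝ) := by rw [Real.mul_rpow (by norm_num) ht]; norm_num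
        _ ≤ 8 * t ^ (m * p) := by gcongr
        _ ≤ _ := by linarith
  rw [Real.rpow_neg (by positivity), Real.exp_neg, ← div_eq_mul_inv, inv_le_comm₀ (by positivity)
    (by positivity), inv_div, div_le_iff₀ (by positivity)]
  linarith

/-- The term `z = 0` gives `1`. Every other `z` has `|z| ^ p ≥ 1`, so a factor `exp (1 - l)` splits
off and leaves the summable `exp (-|z| ^ p)`. -/
theorem exists_sum_exp_neg_mul_le {p : ℝ} (hp : 0 < p) :
    ∃ C : ℝ, 0 < C ∧ ∀ (M : ℕ) (l : ℝ), 1 ≤ l →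
      ∑ z ∈ Finset.Icc (-(M : ℤ)) M, Real.exp (-(l * |(z : ℝ)| ^ p)) ≤ 1 + C * Real.exp (-l) := by
  obtain ⟨C, hC, h⟩ := exists_exp_neg_rpow_le hp
  have hs : Summable fun z : ℤ => 1 / (z : ℝ) ^ 2 :=
    Real.summable_one_div_int_pow.2 one_lt_two
  have hs0 : 0 ≤ ∑' z : ℤ, 1 / (z : ℝ) ^ 2 := tsum_nonneg fun _ => by positivity
  refine ⟨C * Real.exp 1 * (1 + ∑' z : ℤ, 1 / (z : ℝ) ^ 2), by positivity, fun M l hl => ?_⟩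
  have key : ∀ z : ℤ, z ≠ 0 → Real.exp (-(l * |(z : ℝ)| ^ p)) ≤
      C * Real.exp 1 * Real.exp (-l) * (1 / (z : ℝ) ^ 2) := by
    intro z hz
    have hz1 : (1 : ℝ) ≤ |(z : ℝ)| := by exact_mod_cast Int.one_le_abs hz
    have hzp : 1 ≤ |(z : ℝ)| ^ p := Real.one_le_rpow hz1 hp.le
    calc Real.exp (-(l * |(z : ℝ)| ^ p)) ≤ Real.exp (-|(z : ℝ)| ^ p + (1 + -l)) := by
          gcongr
          nlinarith
      _ = Real.exp (-|(z : ℝ)| ^ p) * (Real.exp 1 * Real.exp (-l)) := by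
          rw [Real.exp_add, Real.exp_add]
      _ ≤ C * (1 / (z : ℝ) ^ 2) * (Real.exp 1 * Real.exp (-l)) := by
          gcongr
          refine (h _ (abs_nonneg _)).trans ?_
          gcongr
          rw [Real.rpow_neg (by positivity), one_div]
          gcongr
          calc (z : ℝ) ^ 2 = |(z : ℝ)| ^ (2 : ℝ) := by norm_num
            _ ≤ (1 + |(z : ℝ)|) ^ (2 : ℝ) := by gcongr; linarith
            _ ≤ (1 + |(z : ℝ)|) ^ (3 : ℝ) := by gcongr <;> linarith
      _ = _ := by ring
  have h0 : (0 : ℤ) ∈ Finset.Icc (-(M : ℤ)) M := by simp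
  rw [← Finset.add_sum_erase _ _ h0]
  have e0 : Real.exp (-(l * |((0 : ℤ) : ℝ)| ^ p)) = 1 := by simp [Real.zero_rpow hp.ne']
  rw [e0]
  gcongr
  calc ∑ z ∈ (Finset.Icc (-(M : ℤ)) M).erase 0, Real.exp (-(l * |(z : ℝ)| ^ p))
      ≤ ∑ z ∈ (Finset.Icc (-(M : ℤ)) M).erase 0,
          C * Real.exp 1 * Real.exp (-l) * (1 / (z : ℝ) ^ 2) :=
        Finset.sum_le_sum fun z hz => key z (Finset.ne_of_mem_erase hz)
    _ = C * Real.exp 1 * Real.exp (-l) *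
          ∑ z ∈ (Finset.Icc (-(M : ℤ)) M).erase 0, 1 / (z : ℝ) ^ 2 := by rw [Finset.mul_sum]
    _ ≤ C * Real.exp 1 * Real.exp (-l) * (1 + ∑' z : ℤ, 1 / (z : ℝ) ^ 2) := by
        gcongr
        have := hs.sum_le_tsum ((Finset.Icc (-(M : ℤ)) M).erase 0) fun _ _ => by positivity
        linarith
    _ = _ := by ring

/-- The integer points of a cube that lie in an `ℓ_p` ball. -/
noncomputable def intBall (ι : Type*) [Fintype ι] [DecidableEq ι] (p R : ℝ) (M : ℕ) :
    Finset (ι → ℤ) :=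
  (Fintype.piFinset fun _ : ι => Finset.Icc (-(M : ℤ)) M).filter
    fun z => ∑ i, |(z i : ℝ)| ^ p ≤ R

/-- Chernoff's method: on the ball, `1 ≤ exp (l * (R - ∑ |z i| ^ p))`, and the sum of the right side
over the cube factors into one-dimensional sums. The parameter `l` is left free to balance the two
terms. -/
theorem exists_card_intBall_le {p : ℝ} (hp : 0 < p) :
    ∃ C : ℝ, 0 < C ∧ ∀ (ι : Type) [Fintype ι] [DecidableEq ι] (R : ℝ) (M : ℕ) (l : ℝ), 1 ≤ l →
      ((intBall ι p R M).card : ℝ) ≤ Real.exp (l * R + Fintype.card ι * (C * Real.exp (-l))) := by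
  obtain ⟨C, hC, h⟩ := exists_sum_exp_neg_mul_le hp
  refine ⟨C, hC, fun ι _ _ R M l hl => ?_⟩
  calc ((intBall ι p R M).card : ℝ) = ∑ z ∈ intBall ι p R M, 1 := by simp
    _ ≤ ∑ z ∈ intBall ι p R M, Real.exp (l * R) * ∏ i, Real.exp (-(l * |(z i : ℝ)| ^ p)) := by
        refine Finset.sum_le_sum fun z hz => ?_
        rw [← Real.exp_sum, ← Real.exp_add, Finset.sum_neg_distrib, ← Finset.mul_sum]
        apply Real.one_le_exp
        have := (Finset.mem_filter.1 hz).2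
        nlinarith
    _ ≤ ∑ z ∈ Fintype.piFinset fun _ : ι => Finset.Icc (-(M : ℤ)) M,
          Real.exp (l * R) * ∏ i, Real.exp (-(l * |(z i : ℝ)| ^ p)) :=
        Finset.sum_le_sum_of_subset_of_nonneg (Finset.filter_subset _ _)
          fun _ _ _ => by positivity
    _ = Real.exp (l * R) * ∏ _i : ι, ∑ z ∈ Finset.Icc (-(M : ℤ)) M,
          Real.exp (-(l * |(z : ℝ)| ^ p)) := by
        rw [← Finset.mul_sum, Finset.prod_univ_sum]
    _ ≤ Real.exp (l * R) * ∏ _i : ι, Real.exp (C * Real.exp (-l)) := by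
        gcongr with i hi
        refine (h M l hl).trans ?_
        rw [add_comm]
        exact Real.add_one_le_exp _
    _ = _ := by
        rw [Finset.prod_const, Finset.card_univ, ← Real.exp_nat_mul, ← Real.exp_add]

/-! ### Upper bound for `k ≤ 2n`. -/

/-- A nonzero rounded value forces `|t| ≥ 1/2`. The multiplicative form keeps rounded points in a
multiple of the `ℓ_p` ball, where an additive error would accumulate over the coordinates. -/
theorem abs_round_le_two_mul_abs (t : ℝ) : |((round t : ℤ) : ℝ)| ≤ 2 * |t| := by
  by_cases h : round t = 0
  · simp [h]
  · have h1 : (1 : ℝ) ≤ |((round t : ℤ) : ℝ)| := by exact_mod_cast Int.one_le_abs h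
    have h2 := abs_sub_round t
    have h3 : |((round t : ℤ) : ℝ)| ≤ |t| + 1 / 2 := by
      have := abs_sub_abs_le_abs_sub ((round t : ℤ) : ℝ) t
      rw [abs_sub_comm] at this
      linarith
    linarith

/-- The second bound holds because `0` is itself a grid point; it keeps the rounding error inside
the `ℓ_p` unit ball. -/
theorem abs_sub_mul_round_div_le {ε : ℝ} (hε : 0 < ε) (t : ℝ) :
    |t - ε * ((round (t / ε) : ℤ) : ℝ)| ≤ ε / 2 ∧ |t - ε * ((round (t / ε) : ℤ) : ℝ)| ≤ |t| := by
  have h : |t - ε * ((round (t / ε) : ℤ) : ℝ)| = ε * |t / ε - ((round (t / ε) : ℤ) : ℝ)| := by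
    rw [← abs_of_pos hε, ← abs_mul, abs_of_pos hε, mul_sub, mul_div_cancel₀ _ hε.ne']
  rw [h]
  constructor
  · have := abs_sub_round (t / ε)
    nlinarith
  · have := round_le (t / ε) 0
    rw [Int.cast_zero, sub_zero, abs_div, abs_of_pos hε] at this
    calc _ ≤ ε * (|t| / ε) := by gcongr
      _ = |t| := mul_div_cancel₀ _ hε.ne'

theorem ellNorm_mono {p : ℝ≥0∞} (hp : 0 < p) (hp' : p ≠ ∞) {n : ℕ} {x y : Fin n → ℂ}
    (h : ∀ j, ‖x j‖ ≤ ‖y j‖) : ellNorm p x ≤ ellNorm p y := by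
  rw [ellNorm_eq hp hp', ellNorm_eq hp hp']
  gcongr with j hj
  exact h j

/-- Covering `B_p^n` by rounding to the grid `ε ℤ[i]^n`. -/
theorem exists_cover_of_card_intBall_le {p : ℝ≥0∞} (hp : 0 < p) (hp' : p ≠ ∞) {n : ℕ} {ε : ℝ}
    (hε : 0 < ε) {K : ℕ}
    (hK : (intBall (Fin n ⊕ Fin n) p.toReal (2 * (2 / ε) ^ p.toReal) ⌈2 / ε⌉₊).card ≤ K) :
    ∃ T : Finset (Fin n → ℂ), T.card ≤ K ∧ ∀ x, ellNorm p x ≤ 1 →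
      ∃ y ∈ T, (∀ j, ‖(x - y) j‖ ≤ ε) ∧ ellNorm p (x - y) ≤ 1 := by
  classical
  have hpp := ENNReal.toReal_pos hp.ne' hp'
  let F : (Fin n ⊕ Fin n → ℤ) → Fin n → ℂ :=
    fun z j => ⟨ε * (z (Sum.inl j) : ℝ), ε * (z (Sum.inr j) : ℝ)⟩
  refine ⟨(intBall (Fin n ⊕ Fin n) p.toReal (2 * (2 / ε) ^ p.toReal) ⌈2 / ε⌉₊).image F,
    Finset.card_image_le.trans hK, fun x hx => ?_⟩
  let z : Fin n ⊕ Fin n → ℤ :=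
    Sum.elim (fun j => round ((x j).re / ε)) (fun j => round ((x j).im / ε))
  have hz : ∀ t : ℝ, |((round (t / ε) : ℤ) : ℝ)| ≤ 2 / ε * |t| := fun t => by
    refine (abs_round_le_two_mul_abs _).trans_eq ?_
    rw [abs_div, abs_of_pos hε]
    ring
  have hz1 : ∀ j, |(z (Sum.inl j) : ℝ)| ≤ 2 / ε * ‖x j‖ := fun j =>
    (hz _).trans (by gcongr; exact Complex.abs_re_le_norm _)
  have hz2 : ∀ j, |(z (Sum.inr j) : ℝ)| ≤ 2 / ε * ‖x j‖ := fun j =>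
    (hz _).trans (by gcongr; exact Complex.abs_im_le_norm _)
  refine ⟨F z, Finset.mem_image_of_mem F (Finset.mem_filter.2 ⟨?_, ?_⟩), ?_⟩
  · rw [Fintype.mem_piFinset]
    intro i
    rw [Finset.mem_Icc, ← abs_le]
    have hb : |(z i : ℝ)| ≤ ⌈2 / ε⌉₊ := by
      refine le_trans ?_ (Nat.le_ceil (2 / ε))
      rcases i with j | j
      · refine (hz1 j).trans (mul_le_of_le_one_right (by positivity) ?_)
        exact (norm_apply_le_ellNorm hp x j).trans hx
      · refine (hz2 j).trans (mul_le_of_le_one_right (by positivity) ?_)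
        exact (norm_apply_le_ellNorm hp x j).trans hx
    exact_mod_cast hb
  · rw [Fintype.sum_sum_type]
    rw [ellNorm_le_iff hp hp' _ zero_le_one, Real.one_rpow] at hx
    have : ∀ j, (2 / ε * ‖x j‖) ^ p.toReal = (2 / ε) ^ p.toReal * ‖x j‖ ^ p.toReal :=
      fun j => Real.mul_rpow (by positivity) (norm_nonneg _)
    calc _ ≤ ∑ j, (2 / ε * ‖x j‖) ^ p.toReal + ∑ j, (2 / ε * ‖x j‖) ^ p.toReal := by
          gcongr with j hj j hj
          · exact hz1 j
          · exact hz2 j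
      _ = 2 * (2 / ε) ^ p.toReal * ∑ j, ‖x j‖ ^ p.toReal := by
          simp_rw [this]
          rw [← Finset.mul_sum]
          ring
      _ ≤ _ := mul_le_of_le_one_right (by positivity) hx
  · have hre := fun j => abs_sub_mul_round_div_le hε (x j).re
    have him := fun j => abs_sub_mul_round_div_le hε (x j).im
    constructor
    · intro j
      refine (Complex.norm_le_abs_re_add_abs_im _).trans ?_
      change |(x j).re - ε * ((round ((x j).re / ε) : ℤ) : ℝ)| +
        |(x j).im - ε * ((round ((x j).im / ε) : ℤ) : ℝ)| ≤ ε
      linarith [(hre j).1, (him j).1]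
    · refine (ellNorm_mono hp hp' fun j => ?_).trans hx
      rw [← sq_le_sq₀ (norm_nonneg _) (norm_nonneg _), Complex.sq_norm, Complex.sq_norm,
        Complex.normSq_apply, Complex.normSq_apply, ← sq, ← sq, ← sq, ← sq]
      exact add_le_add (sq_le_sq.2 (hre j).2) (sq_le_sq.2 (him j).2)

/-- The upper bound for `k ≤ 2n` as a statement on coverings. -/
theorem exists_cover_le_two_mul {p : ℝ≥0∞} (hp : 0 < p) (hp' : p ≠ ∞) :
    ∃ C : ℝ, 1 ≤ C ∧ ∀ n k : ℕ, 1 ≤ k → (k : ℝ) ≤ 2 * n →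
      ∃ T : Finset (Fin n → ℂ), T.card ≤ 2 ^ (k - 1) ∧ ∀ x, ellNorm p x ≤ 1 →
      ∃ y ∈ T, (∀ j, ‖(x - y) j‖ ≤
        C * ((k : ℝ)⁻¹ * Real.logb 2 (1 + 2 * n / k)) ^ (p⁻¹).toReal) ∧ ellNorm p (x - y) ≤ 1 := by
  have hpp := ENNReal.toReal_pos hp.ne' hp'
  obtain ⟨C, hC, hcard⟩ := exists_card_intBall_le hpp
  have hl2 : 0 < Real.log 2 := Real.log_pos one_lt_two
  have hl2' : Real.log 2 ≤ 1 := by linarith [Real.log_two_lt_d9]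
  -- `A` and `c` make each of the two terms in the counting exponent at most `k * log 2 / 4`. Their
  -- sum is at most `(k - 1) * log 2` once `k ≥ 2`.
  set A : ℝ := 4 * C / Real.log 2 + 1 with hA
  have hA1 : 1 ≤ A := by rw [hA]; linarith [show 0 ≤ 4 * C / Real.log 2 by positivity]
  have hCA : C * Real.exp (-A) ≤ Real.log 2 / 4 := by
    have : 4 * C / Real.log 2 ≤ Real.exp A := by linarith [Real.add_one_le_exp A]
    rw [div_le_iff₀ hl2] at this
    rw [Real.exp_neg, ← div_eq_mul_inv, div_le_iff₀ (Real.exp_pos _)]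
    linarith
  set c : ℝ := Real.log 2 / (4 * (1 + A)) with hc
  have hc0 : 0 < c := by rw [hc]; positivity
  have hcA : c * (1 + A) = Real.log 2 / 4 := by rw [hc]; field_simp
  have hC1 : 1 ≤ 1 + 2 * (2 / c) ^ (p⁻¹).toReal := by
    linarith [show 0 ≤ 2 * (2 / c) ^ (p⁻¹).toReal by positivity]
  refine ⟨1 + 2 * (2 / c) ^ (p⁻¹).toReal, hC1, fun n k hk hkn => ?_⟩
  have hk0 : (0 : ℝ) < k := by exact_mod_cast hk
  have hN : (0 : ℝ) < 2 * n := hk0.trans_le hkn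
  have hq : 1 ≤ 2 * (n : ℝ) / k := by rwa [one_le_div hk0]
  set L := Real.logb 2 (1 + 2 * n / k) with hL
  have hL1 : 1 ≤ L := by
    rw [hL, Real.le_logb_iff_rpow_le one_lt_two (by positivity)]
    norm_num
    linarith
  -- For `k = 1` the count leaves no room, but the single centre `0` suffices because the radius is
  -- at least `1`.
  rcases hk.eq_or_lt with rfl | hk2
  · refine ⟨{0}, by simp, fun x hx => ⟨0, by simp, fun j => ?_, by simpa using hx⟩⟩
    rw [sub_zero]
    refine ((norm_apply_le_ellNorm hp x j).trans hx).trans ?_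
    refine one_le_mul_of_one_le_of_one_le hC1 (Real.one_le_rpow ?_ ENNReal.toReal_nonneg)
    simpa using hL1
  · set ε : ℝ := 2 * (2 / c * ((k : ℝ)⁻¹ * L)) ^ (p⁻¹).toReal with hε
    have hε0 : 0 < ε := by positivity
    have hR : 2 * (2 / ε) ^ p.toReal = c * k / L := by
      have : 2 / ε = ((2 / c * ((k : ℝ)⁻¹ * L))⁻¹) ^ (p⁻¹).toReal := by
        rw [hε, Real.inv_rpow (by positivity)]
        field_simp
      rw [this, ← Real.rpow_mul (by positivity), ENNReal.toReal_inv, inv_mul_cancel₀ hpp.ne',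
        Real.rpow_one]
      field_simp
    have hlog : Real.log (1 + 2 * n / k) = L * Real.log 2 := by
      rw [hL, Real.logb, div_mul_cancel₀ _ hl2.ne']
    have hlog0 : 0 ≤ L * Real.log 2 := by positivity
    have hcount : (intBall (Fin n ⊕ Fin n) p.toReal (2 * (2 / ε) ^ p.toReal) ⌈2 / ε⌉₊).card
        ≤ 2 ^ (k - 1) := by
      -- With this `l`, the factor `exp (-l)` turns the dimension `2n` into at most `k * exp (-A)`.
      have h1 := hcard (Fin n ⊕ Fin n) (2 * (2 / ε) ^ p.toReal) ⌈2 / ε⌉₊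
        (Real.log (1 + 2 * n / k) + A) (by rw [hlog]; linarith)
      have h2 : (Real.log (1 + 2 * n / k) + A) * (2 * (2 / ε) ^ p.toReal) ≤
          k * (Real.log 2 / 4) := by
        rw [hR, hlog, ← hcA]
        have : (L * Real.log 2 + A) * (c * k / L) = c * k * (Real.log 2 + A / L) := by
          field_simp
        rw [this]
        have hAL : A / L ≤ A := div_le_self (by linarith) hL1
        calc c * k * (Real.log 2 + A / L) ≤ c * k * (1 + A) := by gcongr
          _ = _ := by ring
      have h3 : (Fintype.card (Fin n ⊕ Fin n) : ℝ) *
          (C * Real.exp (-(Real.log (1 + 2 * n / k) + A))) ≤ k * (Real.log 2 / 4) := by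
        rw [neg_add, Real.exp_add, Real.exp_neg, Real.exp_log (by positivity)]
        have h4 : (Fintype.card (Fin n ⊕ Fin n) : ℝ) = 2 * n := by
          simp [two_mul]
        rw [h4]
        have h5 : 2 * (n : ℝ) * (1 + 2 * (n : ℝ) / k)⁻¹ ≤ k := by
          rw [← div_eq_mul_inv, div_le_iff₀ (by positivity)]
          have : (k : ℝ) * (1 + 2 * n / k) = k + 2 * n := by field_simp
          linarith
        calc _ = 2 * (n : ℝ) * (1 + 2 * (n : ℝ) / k)⁻¹ * (C * Real.exp (-A)) := by ring
          _ ≤ _ := by gcongr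
      have h6 : ((intBall (Fin n ⊕ Fin n) p.toReal (2 * (2 / ε) ^ p.toReal) ⌈2 / ε⌉₊).card : ℝ)
          ≤ 2 ^ (k - 1) := by
        refine h1.trans ?_
        rw [← Real.exp_log (show (0 : ℝ) < 2 ^ (k - 1) by positivity), Real.log_pow]
        apply Real.exp_le_exp.2
        rw [Nat.cast_sub hk, Nat.cast_one]
        have : (2 : ℝ) ≤ k := by exact_mod_cast hk2
        nlinarith
      exact_mod_cast h6
    obtain ⟨T, hT, hcov⟩ := exists_cover_of_card_intBall_le hp hp' hε0 hcount
    refine ⟨T, hT, fun x hx => ?_⟩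
    obtain ⟨y, hy, h1, h2⟩ := hcov x hx
    refine ⟨y, hy, fun j => (h1 j).trans ?_, h2⟩
    rw [hε, Real.mul_rpow (by positivity) (by positivity), ← mul_assoc]
    gcongr
    linarith

theorem exists_entropyNumber_le_two_mul {p q : ℝ≥0∞} (hp : 0 < p) (hpq : p ≤ q) :
    ∃ C : ℝ, 0 < C ∧ ∀ n k : ℕ, 1 ≤ k → (k : ℝ) ≤ 2 * n →
      entropyNumber k (idEll p q n)
        ≤ C * ((k : ℝ)⁻¹ * Real.logb 2 (1 + 2 * n / k)) ^ expDiff p q := by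
  -- Here `q = ∞` as well and the exponent is `0`, so the trivial bound `1` is enough.
  by_cases hp' : p = ∞
  · subst hp'
    obtain rfl := top_le_iff.1 hpq
    exact ⟨1, one_pos, fun n k _ _ => by simpa [expDiff] using entropyNumber_le_one hp hpq n k⟩
  · have hpp := ENNReal.toReal_pos hp.ne' hp'
    obtain ⟨C, hC, h⟩ := exists_cover_le_two_mul hp hp'
    refine ⟨C ^ (p.toReal * expDiff p q), by positivity, fun n k hk hkn => ?_⟩
    obtain ⟨T, hT, hcov⟩ := h n k hk hkn
    have hk0 : (0 : ℝ) < k := by exact_mod_cast hk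
    have hN : (0 : ℝ) < 2 * n := hk0.trans_le hkn
    have hL : 0 < Real.logb 2 (1 + 2 * n / k) := Real.logb_pos one_lt_two (by
      linarith [show (0 : ℝ) < 2 * n / k by positivity])
    have hε : 0 < C * ((k : ℝ)⁻¹ * Real.logb 2 (1 + 2 * n / k)) ^ (p⁻¹).toReal := by positivity
    have he : C ^ (p.toReal * expDiff p q) *
        ((k : ℝ)⁻¹ * Real.logb 2 (1 + 2 * n / k)) ^ expDiff p q =
        (C * ((k : ℝ)⁻¹ * Real.logb 2 (1 + 2 * n / k)) ^ (p⁻¹).toReal) ^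
          (p.toReal * expDiff p q) := by
      rw [Real.mul_rpow (x := C) (by positivity) (by positivity), ← Real.rpow_mul (by positivity),
        ENNReal.toReal_inv, ← mul_assoc p.toReal⁻¹, inv_mul_cancel₀ hpp.ne', one_mul]
    rw [he]
    refine entropyNumber_le_of_cover (hp.trans_le hpq) (by positivity) T hT fun x hx => ?_
    obtain ⟨y, hy, h1, h2⟩ := hcov x hx
    exact ⟨y, hy, ellNorm_le_of_interpolation hp hp' hpq _ hε h2 h1⟩

/-! ### Upper bound for `k ≥ 2n`. -/

theorem exists_abs_sub_le_div {m : ℕ} (hm : 1 ≤ m) {r : ℝ} (hr : 0 < r) (w : ℝ) (hw : |w| ≤ r) :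
    ∃ i : Fin m, |w - (-r + (2 * (i : ℕ) + 1) * (r / m))| ≤ r / m := by
  have hm0 : (0 : ℝ) < m := by exact_mod_cast hm
  set s : ℝ := (w + r) * m / (2 * r) with hs
  rw [abs_le] at hw
  have hs0 : 0 ≤ s := div_nonneg (mul_nonneg (by linarith) hm0.le) (by positivity)
  have hsm : s ≤ m := by
    rw [hs, div_le_iff₀ (by positivity)]
    nlinarith
  have hw' : ∀ i : ℝ, w - (-r + (2 * i + 1) * (r / m)) = r / m * (2 * (s - i) - 1) := by
    intro i
    rw [hs]
    field_simp
    ring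
  have hrm : 0 < r / m := by positivity
  have main : ∃ i : Fin m, ((i : ℕ) : ℝ) ≤ s ∧ s ≤ (i : ℕ) + 1 := by
    rcases hsm.lt_or_eq with h | h
    · exact ⟨⟨⌊s⌋₊, (Nat.floor_lt hs0).2 h⟩, Nat.floor_le hs0, (Nat.lt_floor_add_one s).le⟩
    -- The right endpoint `w = r` belongs to the last subinterval; the floor would give the index
    -- `m`.
    · refine ⟨⟨m - 1, by omega⟩, ?_, ?_⟩
      · rw [h]
        exact_mod_cast Nat.sub_le m 1
      · rw [h]
        norm_cast
        change m ≤ m - 1 + 1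
        omega
  obtain ⟨i, h1, h2⟩ := main
  refine ⟨i, ?_⟩
  rw [hw', abs_mul, abs_of_pos hrm]
  refine mul_le_of_le_one_right hrm.le (abs_le.2 ⟨?_, ?_⟩) <;> linarith

/-- Subdividing the cubes of a covering in the maximum norm. -/
theorem entropyNumber_le_of_subdivision {p q : ℝ≥0∞} (hq : 0 < q) {n k a b : ℕ} (hn : 1 ≤ n)
    {r : ℝ} (hr : 0 < r) (T : Finset (Fin n → ℂ)) (hT : T.card ≤ 2 ^ a) (hab : a + b ≤ k - 1)
    (h : ∀ x : Fin n → ℂ, ellNorm p x ≤ 1 → ∃ y ∈ T, ∀ j : Fin n, ‖(x - y) j‖ ≤ r) :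
    entropyNumber k (idEll p q n) ≤
      4 * r * (2 : ℝ) ^ (-(b : ℝ) / (2 * n)) * (n : ℝ) ^ (q⁻¹).toReal := by
  classical
  have hn0 : (0 : ℝ) < n := by exact_mod_cast hn
  set s : ℝ := (2 : ℝ) ^ ((b : ℝ) / (2 * n)) with hs
  have hs1 : 1 ≤ s := Real.one_le_rpow one_le_two (by positivity)
  -- Each of the `2n` real coordinates is cut into `m` pieces, which costs `m ^ (2n) ≤ 2 ^ b`
  -- centres. Taking the floor loses a factor `2`, and adding real and imaginary errors another `2`.
  set m : ℕ := ⌊s⌋₊ with hm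
  have hm1 : 1 ≤ m := Nat.le_floor (by simpa using hs1)
  have hm0 : (0 : ℝ) < m := by exact_mod_cast hm1
  have hms : (m : ℝ) ≤ s := Nat.floor_le (by positivity)
  have hsm : s ≤ 2 * m := by
    have := (Nat.lt_floor_add_one s).le
    have : (1 : ℝ) ≤ m := by exact_mod_cast hm1
    linarith
  have hpow : m ^ (2 * n) ≤ 2 ^ b := by
    have : (m : ℝ) ^ (2 * n) ≤ 2 ^ b := by
      calc (m : ℝ) ^ (2 * n) ≤ s ^ (2 * n) := by gcongr
        _ = 2 ^ b := by
          rw [hs, ← Real.rpow_mul_natCast (by norm_num), ← Real.rpow_natCast]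
          congr 1
          push_cast
          field_simp
    exact_mod_cast this
  let t : Fin m → ℝ := fun i => -r + (2 * (i : ℕ) + 1) * (r / m)
  let F : (Fin n → ℂ) × (Fin n ⊕ Fin n → Fin m) → Fin n → ℂ :=
    fun z j => z.1 j + ⟨t (z.2 (Sum.inl j)), t (z.2 (Sum.inr j))⟩
  have hle : 2 * (r / m) * (n : ℝ) ^ (q⁻¹).toReal ≤
      4 * r * (2 : ℝ) ^ (-(b : ℝ) / (2 * n)) * (n : ℝ) ^ (q⁻¹).toReal := by
    gcongr ?_ * _
    rw [neg_div, Real.rpow_neg (by norm_num), ← hs]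
    rw [← mul_div_assoc, ← div_eq_mul_inv, div_le_div_iff₀ hm0 (by positivity)]
    nlinarith [mul_le_mul_of_nonneg_left hsm hr.le]
  refine le_trans ?_ hle
  refine entropyNumber_le_of_cover hq (by positivity) ((T ×ˢ Finset.univ).image F) ?_ ?_
  · calc ((T ×ˢ Finset.univ).image F).card
        ≤ (T ×ˢ (Finset.univ : Finset (Fin n ⊕ Fin n → Fin m))).card := Finset.card_image_le
      _ = T.card * m ^ (2 * n) := by simp [Finset.card_product, two_mul]
      _ ≤ 2 ^ a * 2 ^ b := Nat.mul_le_mul hT hpow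
      _ = 2 ^ (a + b) := (pow_add _ _ _).symm
      _ ≤ 2 ^ (k - 1) := Nat.pow_le_pow_right (by norm_num) hab
  · intro x hx
    obtain ⟨y, hy, hxy⟩ := h x hx
    choose u hu using fun j => exists_abs_sub_le_div hm1 hr ((x - y) j).re
      ((Complex.abs_re_le_norm _).trans (hxy j))
    choose v hv using fun j => exists_abs_sub_le_div hm1 hr ((x - y) j).im
      ((Complex.abs_im_le_norm _).trans (hxy j))
    refine ⟨F (y, Sum.elim u v), Finset.mem_image_of_mem _ (by simp [hy]), ?_⟩
    refine ellNorm_le_of_support hq _ (by positivity) Finset.univ hn (by simp) (fun j _ => ?_)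
      (by simp)
    refine (Complex.norm_le_abs_re_add_abs_im _).trans ?_
    have h1 : ((x - F (y, Sum.elim u v)) j).re = ((x - y) j).re - t (u j) := by
      simp [F]
      ring
    have h2 : ((x - F (y, Sum.elim u v)) j).im = ((x - y) j).im - t (v j) := by
      simp [F]
      ring
    rw [h1, h2]
    linarith [hu j, hv j]

/-- The cover for `2n` has sup-norm radius of order `(2n) ^ (-1/p)`; the remaining `k - 2n` bits
subdivide it. For `p = ∞` the unit cube itself is subdivided. -/
theorem exists_entropyNumber_le_of_two_mul_le {p q : ℝ≥0∞} (hp : 0 < p) (hpq : p ≤ q) :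
    ∃ C : ℝ, 0 < C ∧ ∀ n k : ℕ, 1 ≤ n → 2 * n ≤ k →
      entropyNumber k (idEll p q n)
        ≤ C * ((2 : ℝ) ^ (-(k : ℝ) / (2 * n)) * (2 * (n : ℝ)) ^ (-expDiff p q)) := by
  have hq := hp.trans_le hpq
  by_cases hp' : p = ∞
  · subst hp'
    obtain rfl := top_le_iff.1 hpq
    refine ⟨8, by norm_num, fun n k hn hk => ?_⟩
    have hn1 : (1 : ℝ) ≤ n := by exact_mod_cast hn
    refine (entropyNumber_le_of_subdivision hq hn one_pos {0} (a := 0) (b := k - 1) (by simp)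
      (by omega) fun x hx => ⟨0, by simp, ?_⟩).trans ?_
    · simpa using (ellNorm_top_le_iff x zero_le_one).1 hx
    · have : (2 : ℝ) ^ (-((k - 1 : ℕ) : ℝ) / (2 * n)) ≤ 2 * (2 : ℝ) ^ (-(k : ℝ) / (2 * n)) := by
        calc (2 : ℝ) ^ (-((k - 1 : ℕ) : ℝ) / (2 * n)) ≤ 2 ^ (1 + -(k : ℝ) / (2 * n)) := by
              gcongr
              · norm_num
              rw [Nat.cast_sub (by omega), div_le_iff₀ (by positivity), add_mul,
                div_mul_cancel₀ _ (by positivity)]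
              push_cast
              linarith
          _ = _ := by rw [Real.rpow_add two_pos, Real.rpow_one]
      simp only [ENNReal.inv_top, ENNReal.toReal_zero, Real.rpow_zero, expDiff, sub_zero, neg_zero]
      linarith
  · obtain ⟨C, hC, h⟩ := exists_cover_le_two_mul hp hp'
    refine ⟨8 * C, by positivity, fun n k hn hk => ?_⟩
    have hn0 : (0 : ℝ) < n := by exact_mod_cast hn
    obtain ⟨T, hT, hcov⟩ := h n (2 * n) (by omega) (by simp)
    have hone : ((2 * n : ℕ) : ℝ)⁻¹ * Real.logb 2 (1 + 2 * n / (2 * n : ℕ)) = (2 * (n : ℝ))⁻¹ := by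
      push_cast
      rw [div_self (by positivity), one_add_one_eq_two, Real.logb_self_eq_one one_lt_two, mul_one]
    rw [hone] at hcov
    -- The bits add up exactly: `(2n - 1) + (k - 2n) = k - 1`.
    refine (entropyNumber_le_of_subdivision hq hn (r := C * (2 * (n : ℝ))⁻¹ ^ (p⁻¹).toReal)
      (by positivity) T hT (b := k - 2 * n) (by omega) fun x hx => ?_).trans ?_
    · obtain ⟨y, hy, h1, -⟩ := hcov x hx
      exact ⟨y, hy, h1⟩
    · have h2 : (2 : ℝ) ^ (-((k - 2 * n : ℕ) : ℝ) / (2 * n)) =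
          2 * (2 : ℝ) ^ (-(k : ℝ) / (2 * n)) := by
        have h4 : -((k - 2 * n : ℕ) : ℝ) / (2 * n) = 1 + -(k : ℝ) / (2 * n) := by
          rw [Nat.cast_sub hk]
          push_cast
          field_simp
          ring
        rw [h4, Real.rpow_add two_pos, Real.rpow_one]
      have h3 : (2 * (n : ℝ)) ^ (-expDiff p q) =
          (2 * (n : ℝ))⁻¹ ^ (p⁻¹).toReal * (2 * (n : ℝ)) ^ (q⁻¹).toReal := by
        rw [expDiff, neg_sub, sub_eq_add_neg, add_comm, Real.rpow_add (by positivity),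
          Real.rpow_neg (by positivity), Real.inv_rpow (by positivity)]
      rw [h2, h3]
      calc _ = 8 * C * ((2 : ℝ) ^ (-(k : ℝ) / (2 * n)) *
            ((2 * (n : ℝ))⁻¹ ^ (p⁻¹).toReal * (n : ℝ) ^ (q⁻¹).toReal)) := by ring
        _ ≤ _ := by
            gcongr
            linarith

/-! ### Lower bound for `k ≤ log₂ (2n)`. -/

theorem half_le_entropyNumber {p q : ℝ≥0∞} (hp : 0 < p) (hpq : p ≤ q) {n k : ℕ}
    (hk : 2 ^ (k - 1) ≤ n) : 1 / 2 ≤ entropyNumber k (idEll p q n) := by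
  classical
  have hq := hp.trans_le hpq
  refine le_entropyNumber_of_cover hp hpq fun ε hε y hy => ?_
  -- The origin joins the unit vectors to give `n + 1` points, since `2 ^ (k - 1) = n` is allowed.
  -- Any two of them differ by modulus `1` in some coordinate.
  let x : Option (Fin n) → Fin n → ℂ := fun o => o.elim 0 fun j => Pi.single j 1
  have hx : ∀ o, ellNorm p (x o) ≤ 1 := by
    rintro (_ | j)
    · simp [x, ellNorm_zero hp]
    · refine (ellNorm_le_of_support hp _ zero_le_one {j} le_rfl (by simp) (by simp [x])
        fun i hi => ?_).trans_eq (by simp)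
      simp [x, Finset.mem_singleton.not.1 hi]
  choose φ hφ using fun o => hy (x o) (hx o)
  obtain ⟨o, o', hne, heq⟩ := Fintype.exists_ne_map_eq_of_card_lt φ (by simpa using by omega)
  have hd : ∃ j, ‖x o j - x o' j‖ = 1 := by
    rcases o with _ | i <;> rcases o' with _ | j
    · exact absurd rfl hne
    · exact ⟨j, by simp [x]⟩
    · exact ⟨i, by simp [x]⟩
    · have : i ≠ j := fun h => hne (by rw [h])
      exact ⟨i, by simp [x, this]⟩
  obtain ⟨j, hj⟩ := hd
  have h1 := (norm_apply_le_ellNorm hq _ j).trans (hφ o)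
  have h2 := (norm_apply_le_ellNorm hq _ j).trans (hφ o')
  rw [← heq] at h2
  have h3 := norm_sub_le ((x o - y (φ o)) j) ((x o' - y (φ o)) j)
  simp only [Pi.sub_apply, sub_sub_sub_cancel_right] at h1 h2 h3
  rw [hj] at h3
  linarith

/-! ### Lower bound by volume. -/

open MeasureTheory

theorem integrable_exp_neg_norm_rpow {q : ℝ} (hq : 0 < q) :
    Integrable fun x : ℂ => Real.exp (-‖x‖ ^ q) := by
  obtain ⟨C, hC, h⟩ := exists_exp_neg_rpow_le hq
  refine ((integrable_one_add_norm (E := ℂ) (μ := volume) (r := 3) (by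
    rw [Complex.finrank_real_complex]; norm_num)).const_mul C).mono' ?_ ?_
  · exact (by fun_prop : Measurable fun x : ℂ => Real.exp (-‖x‖ ^ q)).aestronglyMeasurable
  · refine Filter.Eventually.of_forall fun x => ?_
    rw [Real.norm_eq_abs, Real.abs_exp]
    exact h _ (norm_nonneg _)

theorem volume_ellNorm_le_top {n : ℕ} {r : ℝ} (hr : 0 ≤ r) :
    volume {x : Fin n → ℂ | ellNorm ∞ x ≤ r} = ENNReal.ofReal ((Real.pi * r ^ 2) ^ n) := by
  have : {x : Fin n → ℂ | ellNorm ∞ x ≤ r} = Set.univ.pi fun _ => Metric.closedBall 0 r := by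
    ext x
    simp [ellNorm_top_le_iff x hr]
  rw [this, volume_pi_pi]
  simp only [Complex.volume_closedBall, Finset.prod_const, Finset.card_univ, Fintype.card_fin]
  rw [ENNReal.ofReal_pow (by positivity), ENNReal.ofReal_mul (by positivity),
    ENNReal.ofReal_pow hr, mul_comm]
  congr 2
  rw [← NNReal.coe_real_pi, ENNReal.ofReal_coe_nnreal]

-- After scaling to radius `n ^ (1/q)`, the ball for `q < ∞` is `∑ ‖x j‖ ^ q ≤ n`, where `∏ exp (1 -
-- ‖x j‖ ^ q) ≥ 1`. Markov's inequality and Fubini bound its volume by the `n`-th power of a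
-- constant, so no Gamma functions are needed.
open scoped Pointwise in
theorem exists_volume_ellNorm_le {q : ℝ≥0∞} (hq : 0 < q) :
    ∃ J : ℝ, 0 < J ∧ ∀ (n : ℕ) (ε : ℝ), 1 ≤ n → 0 < ε →
      volume {x : Fin n → ℂ | ellNorm q x ≤ ε} ≤
        ENNReal.ofReal ((J * (ε * (n : ℝ) ^ (-(q⁻¹).toReal))) ^ (2 * n)) := by
  by_cases hq' : q = ∞
  · subst hq'
    refine ⟨√Real.pi, by positivity, fun n ε hn hε => ?_⟩
    rw [volume_ellNorm_le_top hε.le]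
    simp [pow_mul, mul_pow, Real.sq_sqrt Real.pi_pos.le]
  · have hqq := ENNReal.toReal_pos hq.ne' hq'
    set I : ℝ := ∫ x : ℂ, Real.exp (-‖x‖ ^ q.toReal) with hI
    have hI0 : 0 ≤ I := integral_nonneg fun _ => (Real.exp_pos _).le
    refine ⟨√(Real.exp 1 * I + 1), by positivity, fun n ε hn hε => ?_⟩
    have hn0 : (0 : ℝ) < n := by exact_mod_cast hn
    set d : ℝ := ε * (n : ℝ) ^ (-(q⁻¹).toReal) with hd
    have hd0 : 0 < d := by positivity
    set V : Set (Fin n → ℂ) := {x | ellNorm q x ≤ (n : ℝ) ^ (q⁻¹).toReal} with hV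
    have hset : {x : Fin n → ℂ | ellNorm q x ≤ ε} = d • V := by
      ext x
      rw [Set.mem_smul_set_iff_inv_smul_mem₀ hd0.ne', hV, Set.mem_ofPred_eq, Set.mem_ofPred_eq]
      have : (d⁻¹ • x : Fin n → ℂ) = ((d⁻¹ : ℝ) : ℂ) • x := by
        ext j
        simp
      rw [this, ellNorm_real_smul hq _ (by positivity), inv_mul_le_iff₀ hd0, hd, mul_assoc,
        ← Real.rpow_add hn0, neg_add_cancel, Real.rpow_zero, mul_one]
    have hVvol : volume V ≤ ENNReal.ofReal ((Real.exp 1 * I) ^ n) := by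
      let g : (Fin n → ℂ) → ℝ := fun x => ∏ j, (Real.exp 1 * Real.exp (-‖x j‖ ^ q.toReal))
      have hg0 : ∀ x, 0 ≤ g x := fun x => Finset.prod_nonneg fun _ _ => by positivity
      have hint : Integrable g :=
        Integrable.fintype_prod fun _ => (integrable_exp_neg_norm_rpow hqq).const_mul _
      have hsub : V ⊆ {x | 1 ≤ ENNReal.ofReal (g x)} := by
        intro x hx
        rw [Set.mem_ofPred_eq, ENNReal.one_le_ofReal]
        rw [hV, Set.mem_ofPred_eq, ellNorm_le_iff hq hq' _ (by positivity),
          ← Real.rpow_mul hn0.le, ENNReal.toReal_inv, inv_mul_cancel₀ hqq.ne', Real.rpow_one] at hx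
        simp only [g, ← Real.exp_add, ← Real.exp_sum]
        apply Real.one_le_exp
        simp only [Finset.sum_add_distrib, Finset.sum_neg_distrib, Finset.sum_const,
          Finset.card_univ, Fintype.card_fin, nsmul_eq_mul, mul_one]
        linarith
      calc volume V ≤ volume {x | 1 ≤ ENNReal.ofReal (g x)} := measure_mono hsub
        _ ≤ ∫⁻ x, ENNReal.ofReal (g x) := by
            simpa using mul_meas_ge_le_lintegral₀ hint.1.aemeasurable.ennreal_ofReal 1
        _ = ENNReal.ofReal (∫ x, g x) :=
            (ofReal_integral_eq_lintegral_ofReal hint (Filter.Eventually.of_forall hg0)).symm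
        _ = ENNReal.ofReal ((Real.exp 1 * I) ^ n) := by
            rw [integral_fintype_prod_volume_eq_pow
              (fun z : ℂ => Real.exp 1 * Real.exp (-‖z‖ ^ q.toReal)), integral_const_mul,
              Fintype.card_fin]
    clear_value d
    rw [hset, Measure.addHaar_smul, mul_pow, mul_comm, ENNReal.ofReal_mul (by positivity)]
    have hfin : Module.finrank ℝ (Fin n → ℂ) = 2 * n := by
      simp [Module.finrank_pi_fintype, mul_comm]
    rw [hfin, abs_of_pos (by positivity)]
    gcongr
    refine hVvol.trans (ENNReal.ofReal_le_ofReal ?_)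
    rw [pow_mul, Real.sq_sqrt (by positivity)]
    gcongr
    linarith

/-- The volume argument. -/
theorem exists_le_entropyNumber_of_volume {p q : ℝ≥0∞} (hp : 0 < p) (hpq : p ≤ q) :
    ∃ c : ℝ, 0 < c ∧ ∀ n k : ℕ, 1 ≤ n →
      c * ((2 : ℝ) ^ (-(k : ℝ) / (2 * n)) * (n : ℝ) ^ (-expDiff p q)) ≤
        entropyNumber k (idEll p q n) := by
  have hq := hp.trans_le hpq
  obtain ⟨J, hJ, hvol⟩ := exists_volume_ellNorm_le hq
  refine ⟨J⁻¹, by positivity, fun n k hn => le_entropyNumber_of_cover hp hpq fun ε hε y hy => ?_⟩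
  have hn0 : (0 : ℝ) < n := by exact_mod_cast hn
  -- The polydisc of radius `a` lies in the `ℓ_p` unit ball; its volume `(π a²) ^ n` is compared
  -- with that of the covering balls.
  set a : ℝ := (n : ℝ) ^ (-(p⁻¹).toReal) with ha
  set d : ℝ := ε * (n : ℝ) ^ (-(q⁻¹).toReal) with hd
  have hsub : {x : Fin n → ℂ | ellNorm ∞ x ≤ a} ⊆ ⋃ i, {x | ellNorm q (x - y i) ≤ ε} := by
    intro x hx
    rw [Set.mem_ofPred_eq, ellNorm_top_le_iff _ (by positivity)] at hx
    obtain ⟨i, hi⟩ := hy x (by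
      refine (ellNorm_le_of_support hp x (by positivity) Finset.univ hn (by simp)
        (fun j _ => hx j) (by simp)).trans_eq ?_
      rw [ha, ← Real.rpow_add hn0, neg_add_cancel, Real.rpow_zero])
    exact Set.mem_iUnion.2 ⟨i, hi⟩
  have h1 : ENNReal.ofReal ((Real.pi * a ^ 2) ^ n) ≤
      ENNReal.ofReal (2 ^ (k - 1) * (J * d) ^ (2 * n)) := by
    rw [← volume_ellNorm_le_top (by positivity)]
    calc _ ≤ volume (⋃ i, {x | ellNorm q (x - y i) ≤ ε}) := measure_mono hsub
      _ ≤ ∑ i, volume {x | ellNorm q (x - y i) ≤ ε} := measure_iUnion_fintype_le _ _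
      _ = ∑ _i : Fin (2 ^ (k - 1)), volume {x : Fin n → ℂ | ellNorm q x ≤ ε} := by
          refine Finset.sum_congr rfl fun i _ => ?_
          simp_rw [sub_eq_add_neg]
          exact measure_preimage_add_right volume (-y i) {x | ellNorm q x ≤ ε}
      _ ≤ ∑ _i : Fin (2 ^ (k - 1)), ENNReal.ofReal ((J * d) ^ (2 * n)) :=
          Finset.sum_le_sum fun i _ => hvol n ε hn hε
      _ = _ := by
          rw [ENNReal.ofReal_mul (by positivity)]
          simp [ENNReal.ofReal_pow]
  rw [ENNReal.ofReal_le_ofReal_iff (by positivity)] at h1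
  have h2 : a ^ (2 * n) ≤ ((2 : ℝ) ^ ((k : ℝ) / (2 * n)) * (J * d)) ^ (2 * n) := by
    calc a ^ (2 * n) ≤ (Real.pi * a ^ 2) ^ n := by
          rw [pow_mul]
          gcongr
          nlinarith [Real.pi_gt_three, sq_nonneg a]
      _ ≤ 2 ^ (k - 1) * (J * d) ^ (2 * n) := h1
      _ ≤ 2 ^ k * (J * d) ^ (2 * n) := by
          gcongr
          · norm_num
          · omega
      _ = _ := by
          rw [mul_pow ((2 : ℝ) ^ ((k : ℝ) / (2 * n))), ← Real.rpow_mul_natCast (by norm_num)]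
          congr 1
          rw [← Real.rpow_natCast]
          congr 1
          push_cast
          field_simp
  have h3 := (pow_le_pow_iff_left₀ (by positivity) (by positivity) (by omega)).1 h2
  rw [expDiff, neg_sub, sub_eq_add_neg, add_comm, Real.rpow_add hn0, ← ha, neg_div,
    Real.rpow_neg two_pos.le]
  have h4 : (n : ℝ) ^ (q⁻¹).toReal * d = ε := by
    rw [hd, mul_left_comm, ← Real.rpow_add hn0, add_neg_cancel, Real.rpow_zero, mul_one]
  rw [← h4]
  calc _ ≤ J⁻¹ * (((2 : ℝ) ^ ((k : ℝ) / (2 * n)))⁻¹ *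
        (((2 : ℝ) ^ ((k : ℝ) / (2 * n)) * (J * d)) * (n : ℝ) ^ (q⁻¹).toReal)) := by gcongr
    _ = _ := by field_simp

/-! ### Lower bound by codes. -/

/-- Hamming balls of relative radius `1/2` over an alphabet with `b²` letters. -/
theorem card_hammingDist_le {m b B : ℕ} (hb : 1 ≤ b) (hB : B = b ^ 2) (f : Fin m → Fin B) :
    (Finset.univ.filter fun g : Fin m → Fin B => 2 * hammingDist f g ≤ m).card ≤
      (2 * b) ^ m := by
  classical
  have hb0 : (1 : ℝ) ≤ b := by exact_mod_cast hb
  -- A changed letter has weight `b ^ (-2)`, so the weights at one position sum to at most `2`. A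
  -- word at distance `d ≤ m/2` has total weight `b ^ (-2d) ≥ b ^ (-m)`.
  let w : Fin m → Fin B → ℝ := fun i v => if f i ≠ v then ((b : ℝ) ^ 2)⁻¹ else 1
  have hw0 : ∀ i v, 0 ≤ w i v := fun i v => by
    dsimp only [w]
    split_ifs <;> positivity
  have hsum : ∀ i, ∑ v, w i v ≤ 2 := by
    intro i
    calc ∑ v, w i v ≤ ∑ v : Fin B, (((b : ℝ) ^ 2)⁻¹ + if f i = v then 1 else 0) := by
          refine Finset.sum_le_sum fun v _ => ?_
          dsimp only [w]
          by_cases h : f i = v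
          · simp [h]
          · simp [h]
      _ = 2 := by
          rw [Finset.sum_add_distrib]
          simp only [Finset.sum_const, Finset.card_univ, Fintype.card_fin, hB, nsmul_eq_mul,
            Finset.sum_ite_eq, Finset.mem_univ, if_true]
          push_cast
          field_simp
          norm_num
  have hprod : ∀ g : Fin m → Fin B, 2 * hammingDist f g ≤ m →
      1 ≤ (b : ℝ) ^ m * ∏ i, w i (g i) := by
    intro g hg
    have : ∏ i, w i (g i) = (((b : ℝ) ^ 2)⁻¹) ^ hammingDist f g := by
      simp only [w, Finset.prod_ite, Finset.prod_const, mul_one, one_pow]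
      rfl
    rw [this, inv_pow, ← pow_mul, ← div_eq_mul_inv, one_le_div (by positivity)]
    exact pow_le_pow_right₀ hb0 hg
  have hreal : ((Finset.univ.filter fun g : Fin m → Fin B =>
      2 * hammingDist f g ≤ m).card : ℝ) ≤ (2 * b) ^ m := by
    calc _ = ∑ g ∈ Finset.univ.filter fun g : Fin m → Fin B => 2 * hammingDist f g ≤ m,
          (1 : ℝ) := by simp
      _ ≤ ∑ g ∈ Finset.univ.filter fun g : Fin m → Fin B => 2 * hammingDist f g ≤ m,
          (b : ℝ) ^ m * ∏ i, w i (g i) :=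
          Finset.sum_le_sum fun g hg => hprod g (Finset.mem_filter.1 hg).2
      _ ≤ ∑ g : Fin m → Fin B, (b : ℝ) ^ m * ∏ i, w i (g i) :=
          Finset.sum_le_sum_of_subset_of_nonneg (Finset.filter_subset _ _) fun g _ _ =>
            mul_nonneg (by positivity) (Finset.prod_nonneg fun i _ => hw0 i _)
      _ = (b : ℝ) ^ m * ∏ i, ∑ v, w i v := by
          rw [← Finset.mul_sum, Finset.prod_univ_sum, Fintype.piFinset_univ]
      _ ≤ (b : ℝ) ^ m * ∏ _i : Fin m, (2 : ℝ) := by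
          refine mul_le_mul_of_nonneg_left (Finset.prod_le_prod (fun i _ => ?_) fun i _ => ?_)
            (by positivity)
          · exact Finset.sum_nonneg fun v _ => hw0 i v
          · exact hsum i
      _ = _ := by simp [mul_pow, mul_comm]
  exact_mod_cast hreal

/-- The sparse vector that carries the value `a` on the coordinates selected by the word `f`. -/
noncomputable def codeVector {m B n : ℕ} (e : Fin m × Fin B ↪ Fin n) (a : ℝ) (f : Fin m → Fin B) :
    Fin n → ℂ :=
  open Classical in fun j => if ∃ i, e (i, f i) = j then (a : ℂ) else 0

theorem ellNorm_codeVector_le {p : ℝ≥0∞} (hp : 0 < p) {m B n : ℕ} (hm : 1 ≤ m)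
    (e : Fin m × Fin B ↪ Fin n) {a : ℝ} (ha : 0 ≤ a) (f : Fin m → Fin B) :
    ellNorm p (codeVector e a f) ≤ a * (m : ℝ) ^ (p⁻¹).toReal := by
  classical
  refine ellNorm_le_of_support hp _ ha (Finset.univ.image fun i => e (i, f i)) hm
    (Finset.card_image_le.trans (by simp)) (fun j _ => ?_) fun j hj => ?_
  · unfold codeVector
    split_ifs
    · simp [abs_of_nonneg ha]
    · simpa using ha
  · unfold codeVector
    rw [if_neg]
    simpa using hj

/-- Wherever the words differ, the coordinate selected by `f` carries `a` in one vector and `0` in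
the other; injectivity of `e` keeps these coordinates distinct. Strictness in `hfg` makes this set
nonempty, as `q = ∞` requires. -/
theorem le_ellNorm_codeVector_sub {q : ℝ≥0∞} (hq : 0 < q) {m B n : ℕ}
    (e : Fin m × Fin B ↪ Fin n) {a : ℝ} (ha : 0 ≤ a) (f g : Fin m → Fin B)
    (hfg : m < 2 * hammingDist f g) :
    a * ((m : ℝ) / 2) ^ (q⁻¹).toReal ≤ ellNorm q (codeVector e a f - codeVector e a g) := by
  classical
  set S : Finset (Fin n) := (Finset.univ.filter fun i => f i ≠ g i).image fun i => e (i, f i)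
  have hcard : S.card = hammingDist f g := by
    refine Finset.card_image_of_injective _ fun i i' h => ?_
    exact congrArg Prod.fst (e.injective h)
  refine le_ellNorm_of_le hq _ ha S ?_ (by positivity) ?_ fun j hj => ?_
  · rw [← Finset.card_pos]
    omega
  · rw [hcard, div_le_iff₀ two_pos]
    have : (m : ℝ) < 2 * hammingDist f g := by exact_mod_cast hfg
    linarith
  · obtain ⟨i, hi, rfl⟩ := Finset.mem_image.1 hj
    have hne := (Finset.mem_filter.1 hi).2
    have h1 : codeVector e a f (e (i, f i)) = a := if_pos ⟨i, rfl⟩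
    have h2 : codeVector e a g (e (i, f i)) = 0 := by
      refine if_neg ?_
      rintro ⟨i', h⟩
      have := e.injective h
      rw [Prod.mk.injEq] at this
      obtain ⟨rfl, h'⟩ := this
      exact hne h'.symm
    rw [Pi.sub_apply, h1, h2, sub_zero, Complex.norm_real, Real.norm_eq_abs]
    exact le_abs_self a

/-- There are `b ^ (2m)` words, so `hk` forces more than `(2b) ^ m` of them into one covering ball.
This exceeds the size of a Hamming ball of radius `m/2`, so that covering ball contains two words
far apart. -/
theorem le_entropyNumber_of_code {p q : ℝ≥0∞} (hp : 0 < p) (hpq : p ≤ q) {n k m b : ℕ}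
    (hm : 1 ≤ m) (hb : 1 ≤ b) (hn : m * b ^ 2 ≤ n) (hk : 2 ^ (k - 1) * 2 ^ m < b ^ m) :
    (2 * 4 ^ (q⁻¹).toReal)⁻¹ * (m : ℝ) ^ (-expDiff p q) ≤ entropyNumber k (idEll p q n) := by
  classical
  have hq := hp.trans_le hpq
  have hm0 : (0 : ℝ) < m := by exact_mod_cast hm
  obtain ⟨e⟩ : Nonempty (Fin m × Fin (b ^ 2) ↪ Fin n) :=
    Function.Embedding.nonempty_of_card_le (by simpa using hn)
  set a : ℝ := (m : ℝ) ^ (-(p⁻¹).toReal) with ha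
  refine le_entropyNumber_of_cover hp hpq fun ε hε y hy => ?_
  choose φ hφ using fun f : Fin m → Fin (b ^ 2) => hy (codeVector e a f) (by
    refine (ellNorm_codeVector_le hp hm e (by positivity) f).trans_eq ?_
    rw [ha, ← Real.rpow_add hm0, neg_add_cancel, Real.rpow_zero])
  obtain ⟨i, -, hi⟩ := Finset.exists_lt_card_fiber_of_mul_lt_card_of_maps_to
    (s := Finset.univ) (t := Finset.univ) (f := φ) (n := (2 * b) ^ m) (fun _ _ => Finset.mem_univ _)
    (by
      simp only [Finset.card_univ, Fintype.card_fin, Fintype.card_fun]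
      calc 2 ^ (k - 1) * (2 * b) ^ m = (2 ^ (k - 1) * 2 ^ m) * b ^ m := by rw [mul_pow]; ring
        _ < b ^ m * b ^ m := Nat.mul_lt_mul_of_pos_right hk (by positivity)
        _ = (b ^ 2) ^ m := by rw [← mul_pow, sq])
  obtain ⟨f, hf⟩ : (Finset.univ.filter fun f => φ f = i).Nonempty :=
    Finset.card_pos.1 (Nat.zero_lt_of_lt hi)
  obtain ⟨g, hg, hfg⟩ : ∃ g, φ g = i ∧ m < 2 * hammingDist f g := by
    by_contra! hcon
    refine absurd (Finset.card_le_card fun g hg => ?_)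
      (not_le.2 ((card_hammingDist_le hb rfl f).trans_lt hi))
    exact Finset.mem_filter.2 ⟨Finset.mem_univ _, hcon g (Finset.mem_filter.1 hg).2⟩
  have hf' := (Finset.mem_filter.1 hf).2
  have h1 := hφ f
  have h2 := hφ g
  rw [hf'] at h1
  rw [hg] at h2
  have h3 := ellNorm_sub_le hq _ _ hε.le h1 h2
  rw [sub_sub_sub_cancel_right] at h3
  have h4 := (le_ellNorm_codeVector_sub hq e (by positivity : 0 ≤ a) f g hfg).trans h3
  rw [expDiff, neg_sub, sub_eq_add_neg, add_comm, Real.rpow_add hm0, ← ha,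
    inv_mul_le_iff₀ (by positivity)]
  rw [Real.div_rpow hm0.le two_pos.le, ← mul_div_assoc, div_le_iff₀ (by positivity)] at h4
  refine h4.trans_eq ?_
  have : (4 : ℝ) ^ (q⁻¹).toReal = 2 ^ (q⁻¹).toReal * 2 ^ (q⁻¹).toReal := by
    rw [← Real.mul_rpow two_pos.le two_pos.le]
    norm_num
  rw [this]
  ring

/-- A choice of code parameters for `k` small compared with `n`. -/
theorem exists_code_parameters {n k : ℕ} (hk1 : 1 ≤ k) (hk : Real.logb 2 (2 * n) ≤ k)
    (hkn : 2 ^ 14 * k ≤ n) :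
    ∃ m b : ℕ, 1 ≤ m ∧ 1 ≤ b ∧ m * b ^ 2 ≤ n ∧ 2 ^ (k - 1) * 2 ^ m < b ^ m ∧
      (m : ℝ) ≤ 16 * (k / Real.logb 2 (1 + 2 * n / k)) := by
  have hk0 : (1 : ℝ) ≤ k := by exact_mod_cast hk1
  have hkn' : 2 ^ 14 * (k : ℝ) ≤ n := by exact_mod_cast hkn
  have hn1 : (1 : ℝ) ≤ n := by nlinarith
  set u : ℝ := n / k with hu
  have hnu : (n : ℝ) = u * k := by rw [hu]; field_simp
  have hu14 : 2 ^ 14 ≤ u := by rw [hu, le_div_iff₀ (by positivity)]; exact hkn'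
  have hun : u ≤ n := div_le_self (by positivity) hk0
  have hX : 1 + 2 * (n : ℝ) / k = 1 + 2 * u := by rw [hu]; ring
  rw [hX]
  set X : ℝ := 1 + 2 * u with hXdef
  have hX1 : 1 ≤ X := by linarith
  set L : ℝ := Real.logb 2 X with hL
  have h2L : (2 : ℝ) ^ L = X := Real.rpow_logb two_pos (by norm_num) (by linarith)
  have hL1 : 1 ≤ L := by
    rw [hL, Real.le_logb_iff_rpow_le one_lt_two (by linarith), Real.rpow_one]
    linarith
  have hLk : L ≤ 2 * k := by
    have : L ≤ Real.logb 2 (2 * (2 * n)) :=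
      Real.logb_le_logb_of_le one_lt_two (by linarith) (by linarith)
    rw [Real.logb_mul (by norm_num) (by positivity), Real.logb_self_eq_one one_lt_two] at this
    linarith
  -- The fourth root makes the alphabet size `b ^ 2` only of order `√X`, which leaves room for `m *
  -- b ^ 2 ≤ n`.
  set s : ℝ := X ^ (1 / 4 : ℝ) with hs
  have hs4 : s ^ 4 = X := by
    rw [hs, ← Real.rpow_mul_natCast (by linarith)]
    norm_num
  have hs0 : 0 ≤ s := by positivity
  have hs3 : 3 < s := lt_of_pow_lt_pow_left₀ 4 hs0 (by rw [hs4]; linarith)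
  set b : ℕ := ⌈s⌉₊ with hb
  have hbs : s ≤ b := Nat.le_ceil s
  have hb2 : (b : ℝ) ≤ 2 * s := by
    have := (Nat.ceil_lt_add_one hs0).le
    linarith
  have hb4 : 4 ≤ b := by
    have : (3 : ℝ) < b := hs3.trans_le hbs
    exact_mod_cast this
  -- Since `b ≥ 2 ^ (L/4)`, this gives `b ^ m ≥ 2 ^ (2k)`. Rounding up at most doubles `8 * (k /
  -- L)`, because `L ≤ 2k` by the hypothesis on `log₂ (2n)`.
  set m : ℕ := ⌈8 * (k / L)⌉₊ with hm
  have hkL : 1 / 2 ≤ k / L := by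
    rw [le_div_iff₀ (by linarith)]
    linarith
  have hmle : 8 * (k / L) ≤ m := Nat.le_ceil _
  have hm16 : (m : ℝ) ≤ 16 * (k / L) := by
    have := (Nat.ceil_lt_add_one (show 0 ≤ 8 * (k / L) by positivity)).le
    linarith
  have hbm : 2 ^ (2 * k) ≤ b ^ m := by
    have hs2 : s = 2 ^ (L / 4) := by
      rw [hs, ← h2L, ← Real.rpow_mul two_pos.le]
      congr 1
      ring
    have : (2 : ℝ) ^ (2 * k) ≤ b ^ m := by
      calc (2 : ℝ) ^ (2 * k) = 2 ^ ((2 * k : ℕ) : ℝ) := (Real.rpow_natCast _ _).symm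
        _ ≤ 2 ^ (L / 4 * m) := by
            gcongr
            · norm_num
            · push_cast
              calc 2 * (k : ℝ) = L / 4 * (8 * (k / L)) := by field_simp; norm_num
                _ ≤ _ := by gcongr
        _ = s ^ m := by rw [Real.rpow_mul_natCast two_pos.le, hs2]
        _ ≤ b ^ m := by gcongr
    exact_mod_cast this
  refine ⟨m, b, ?_, by omega, ?_, ?_, hm16⟩
  · have : (0 : ℝ) < m := by linarith
    exact_mod_cast this
  · have hsu : 64 * s ^ 2 ≤ u := by
      refine le_of_sq_le_sq ?_ (by linarith)
      have : (64 * s ^ 2) ^ 2 = 4096 * X := by rw [← hs4]; ring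
      rw [this, hXdef]
      nlinarith
    have : (m : ℝ) * b ^ 2 ≤ n := by
      calc (m : ℝ) * b ^ 2 ≤ 16 * k * (2 * s) ^ 2 := by
            gcongr
            refine hm16.trans ?_
            gcongr
            exact div_le_self (by positivity) hL1
        _ = k * (64 * s ^ 2) := by ring
        _ ≤ k * u := by gcongr
        _ = n := by rw [hnu, mul_comm]
    exact_mod_cast this
  · have h1 : (2 ^ m * 2 ^ k) ^ 2 ≤ (b ^ m) ^ 2 := by
      calc (2 ^ m * 2 ^ k) ^ 2 = 4 ^ m * 2 ^ (2 * k) := by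
            rw [show 4 = 2 ^ 2 by norm_num, ← pow_mul, ← pow_add, ← pow_add, ← pow_mul]
            ring
        _ ≤ b ^ m * b ^ m := by gcongr
        _ = _ := (sq _).symm
    have h2 : 2 ^ m * 2 ^ k ≤ b ^ m := (Nat.pow_le_pow_iff_left two_ne_zero).1 h1
    refine lt_of_lt_of_le ?_ h2
    rw [mul_comm]
    gcongr
    · norm_num
    · omega

/-! ### Lower bound for the middle range and conclusion. -/

theorem exists_le_entropyNumber_le_two_mul {p q : ℝ≥0∞} (hp : 0 < p) (hpq : p ≤ q) :
    ∃ c : ℝ, 0 < c ∧ ∀ n k : ℕ, 1 ≤ n → 1 ≤ k → Real.logb 2 (2 * n) ≤ k → (k : ℝ) ≤ 2 * n →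
      c * ((k : ℝ)⁻¹ * Real.logb 2 (1 + 2 * n / k)) ^ expDiff p q ≤
        entropyNumber k (idEll p q n) := by
  have hD := expDiff_nonneg hp hpq
  obtain ⟨c, hc, hvol⟩ := exists_le_entropyNumber_of_volume hp hpq
  set c₁ : ℝ := (2 * 4 ^ (q⁻¹).toReal)⁻¹ * 16 ^ (-expDiff p q) with hc₁
  set c₂ : ℝ := c * (1 / 2) * (2 ^ 18) ^ (-expDiff p q) with hc₂
  have hc₁0 : 0 < c₁ := by positivity
  have hc₂0 : 0 < c₂ := by positivity
  refine ⟨min c₁ c₂, lt_min hc₁0 hc₂0, fun n k hn hk hnk hkn => ?_⟩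
  have hk0 : (0 : ℝ) < k := by exact_mod_cast hk
  have hn0 : (0 : ℝ) < n := by exact_mod_cast hn
  set L := Real.logb 2 (1 + 2 * n / k) with hL
  have hL0 : 0 < L := Real.logb_pos one_lt_two (by
    linarith [show (0 : ℝ) < 2 * n / k by positivity])
  -- Codes handle `k` small against `n`. Otherwise `k` and `n` are comparable and `L ≤ 16`, so the
  -- volume bound has the right order; `2 ^ 18` is `16 * 2 ^ 14`.
  rcases le_or_gt (2 ^ 14 * k) n with h | h
  · obtain ⟨m, b, hm, hb, hmb, hlt, hmk⟩ := exists_code_parameters hk hnk h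
    refine le_trans ?_ (le_entropyNumber_of_code hp hpq hm hb hmb hlt)
    calc min c₁ c₂ * ((k : ℝ)⁻¹ * L) ^ expDiff p q
        ≤ c₁ * ((k : ℝ)⁻¹ * L) ^ expDiff p q := by gcongr; exact min_le_left _ _
      _ = (2 * 4 ^ (q⁻¹).toReal)⁻¹ * (16 * (k / L)) ^ (-expDiff p q) := by
          rw [hc₁, mul_assoc, Real.mul_rpow (x := 16) (by norm_num) (by positivity),
            Real.rpow_neg (x := k / L) (by positivity), ← Real.inv_rpow (by positivity), inv_div,
            div_eq_inv_mul]
      _ ≤ _ := by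
          refine mul_le_mul_of_nonneg_left ?_ (by positivity)
          exact Real.rpow_le_rpow_of_nonpos (by exact_mod_cast hm) hmk (by linarith)
  · have h' : (n : ℝ) ≤ 2 ^ 14 * k := by exact_mod_cast h.le
    refine le_trans ?_ (hvol n k hn)
    have hL16 : L ≤ 16 := by
      rw [hL, Real.logb_le_iff_le_rpow one_lt_two (by positivity)]
      have : (n : ℝ) / k ≤ 2 ^ 14 := by rwa [div_le_iff₀ hk0]
      rw [mul_div_assoc]
      norm_num
      linarith
    have h1 : (k : ℝ)⁻¹ * L ≤ 2 ^ 18 * (n : ℝ)⁻¹ := by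
      rw [← div_eq_inv_mul, ← div_eq_mul_inv, div_le_div_iff₀ hk0 hn0]
      nlinarith
    have h2 : (1 / 2 : ℝ) ≤ 2 ^ (-(k : ℝ) / (2 * n)) := by
      calc (1 / 2 : ℝ) = 2 ^ (-1 : ℝ) := by rw [Real.rpow_neg_one]; norm_num
        _ ≤ _ := by
          gcongr
          · norm_num
          · rw [le_div_iff₀ (by positivity)]
            linarith
    calc min c₁ c₂ * ((k : ℝ)⁻¹ * L) ^ expDiff p q
        ≤ c₂ * (2 ^ 18 * (n : ℝ)⁻¹) ^ expDiff p q := by gcongr; exact min_le_right _ _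
      _ = c * (1 / 2 * (n : ℝ) ^ (-expDiff p q)) := by
          rw [hc₂, Real.mul_rpow (by norm_num) (by positivity), Real.inv_rpow hn0.le,
            ← Real.rpow_neg hn0.le, Real.rpow_neg (x := 2 ^ 18) (by norm_num)]
          field_simp
      _ ≤ _ := by gcongr

theorem mainTheorem1 (p q : ℝ≥0∞) (hp : 0 < p) (hpq : p ≤ q) :
    ∃ c C : ℝ, 0 < c ∧ 0 < C ∧ ∀ n k : ℕ, 1 ≤ n → 1 ≤ k →
      ((k : ℝ) ≤ Real.logb 2 (2 * n) →
        c ≤ entropyNumber k (idEll p q n) ∧ entropyNumber k (idEll p q n) ≤ C) ∧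
      (Real.logb 2 (2 * n) ≤ k → (k : ℝ) ≤ 2 * n →
        c * ((k : ℝ)⁻¹ * Real.logb 2 (1 + 2 * n / k)) ^ expDiff p q
            ≤ entropyNumber k (idEll p q n) ∧
        entropyNumber k (idEll p q n)
            ≤ C * ((k : ℝ)⁻¹ * Real.logb 2 (1 + 2 * n / k)) ^ expDiff p q) ∧
      (2 * (n : ℝ) ≤ k →
        c * ((2 : ℝ) ^ (-(k : ℝ) / (2 * n)) * (2 * (n : ℝ)) ^ (-expDiff p q))
            ≤ entropyNumber k (idEll p q n) ∧
        entropyNumber k (idEll p q n)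
            ≤ C * ((2 : ℝ) ^ (-(k : ℝ) / (2 * n)) * (2 * (n : ℝ)) ^ (-expDiff p q))) := by
  have hD := expDiff_nonneg hp hpq
  obtain ⟨c₂, hc₂, hlow₂⟩ := exists_le_entropyNumber_le_two_mul hp hpq
  obtain ⟨c₃, hc₃, hlow₃⟩ := exists_le_entropyNumber_of_volume hp hpq
  obtain ⟨C₂, hC₂, hup₂⟩ := exists_entropyNumber_le_two_mul hp hpq
  obtain ⟨C₃, hC₃, hup₃⟩ := exists_entropyNumber_le_of_two_mul_le hp hpq
  refine ⟨min (1 / 2) (min c₂ c₃), max 1 (max C₂ C₃), by positivity, by positivity,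
    fun n k hn hk => ⟨fun h => ⟨?_, ?_⟩, fun h h' => ⟨?_, ?_⟩, fun h => ⟨?_, ?_⟩⟩⟩
  · refine (min_le_left _ _).trans (half_le_entropyNumber hp hpq ?_)
    rw [Real.le_logb_iff_rpow_le one_lt_two (by positivity), Real.rpow_natCast] at h
    have h1 : 2 ^ k ≤ 2 * n := by exact_mod_cast h
    obtain ⟨j, rfl⟩ : ∃ j, k = j + 1 := ⟨k - 1, by omega⟩
    rw [pow_succ] at h1
    simpa using (by omega : 2 ^ j ≤ n)
  · exact (entropyNumber_le_one hp hpq n k).trans (le_max_left _ _)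
  · have hL : 0 ≤ Real.logb 2 (1 + 2 * n / k) := Real.logb_nonneg one_lt_two (by
      linarith [show (0 : ℝ) ≤ 2 * n / k by positivity])
    refine le_trans ?_ (hlow₂ n k hn hk h h')
    gcongr
    exact (min_le_right _ _).trans (min_le_left _ _)
  · have hL : 0 ≤ Real.logb 2 (1 + 2 * n / k) := Real.logb_nonneg one_lt_two (by
      linarith [show (0 : ℝ) ≤ 2 * n / k by positivity])
    refine (hup₂ n k hk h').trans ?_
    gcongr
    exact (le_max_left _ _).trans (le_max_right _ _)
  · have hn0 : (0 : ℝ) < n := by exact_mod_cast hn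
    refine le_trans ?_ (hlow₃ n k hn)
    have h1 : (2 * (n : ℝ)) ^ (-expDiff p q) ≤ (n : ℝ) ^ (-expDiff p q) :=
      Real.rpow_le_rpow_of_nonpos hn0 (by linarith) (by linarith)
    gcongr
    exact (min_le_right _ _).trans (min_le_right _ _)
  · refine (hup₃ n k hn (by exact_mod_cast h)).trans ?_
    gcongr
    exact (le_max_right _ _).trans (le_max_right _ _)
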